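/- Let $X=X_\Sigma$ be a smooth projective toric variety over $\mathbb C$ with rays $\rho\in\Sigma(1)$, torus-invariant divisors $D_\rho$, homogeneous coordinate ring $S=\mathbb C[x_\rho\mid\rho\in\Sigma(1)]$ graded by $\mathrm{Pic}(X)$ with $\deg x_\rho=[D_\rho]$, and irrelevant locus $Z(\Sigma)\subset\mathbb C^{\Sigma(1)}$. Put $G=\mathrm{Hom}(\mathrm{Pic}(X),\mathbb C^*)$, so that $X=(\mathbb C^{\Sigma(1)}-Z(\Sigma))/G$, and $W=\mathrm{Pic}(X)\otimes_{\mathbb Z}\mathbb C$. Let $E_\rho\in S_{[D_\rho]}\otimes W=H^0(X,\mathcal O_X(D_\rho))\otimes W$ for $\rho\in\Sigma(1)$ be such that the induced map $E$ is injective, and define the sheaf $\mathcal E$ by the exact sequence $$0\to\mathcal O_X\otimes W^\vee\xrightarrow{\;E=(E_\rho)\;}\bigoplus_\rho\mathcal O_X(D_\rho)\to\mathcal E\to0 .$$ Let $\beta\in H_2(X,\mathbb Z)=\mathrm{Hom}(\mathrm{Pic}(X),\mathbb Z)$ (for instance an integral class in the Mori cone) and $d_\rho=D_\rho\cdot\beta$.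 Let $\mathbb C_\beta=\bigoplus_\rho H^0(\mathbb P^1,\mathcal O(d_\rho))$, with coordinates $f_{\rho_i}$ ($\rho\in\Sigma(1)$, $0\le i\le d_\rho$) given by $f_\rho(t)=\sum_{i=0}^{d_\rho}f_{\rho_i}t_0^it_1^{d_\rho-i}$ (so $f_\rho=0$ if $d_\rho<0$); let $G$ act on $f_{\rho_i}$ with weight $[D_\rho]$. Let $Z_\beta\subset\mathbb C_\beta$ be the set of all $f$ with $f(t)\in Z(\Sigma)$ for all $t\in\mathbb C^2$, and $X_\beta=(\mathbb C_\beta-Z_\beta)/G$. For each $\rho_i$ let $\mathcal O_{X_\beta}(D_{\rho_i})$ be the sheaf of regular functions on $G$-invariant open subsets of $\mathbb C_\beta-Z_\beta$ on which $G$ acts with weight $[D_\rho]$. Substitute $x_\rho=f_\rho(t)$ and expand $$E_\rho(f(t))=\sum_{i=0}^{d_\rho}E_{\rho_i}(f)\,t_0^it_1^{d_\rho-i}.$$ The $W$-valued polynomials $E_{\rho_i}$ define a map $\hat F:\mathcal O_{X_\beta}\otimes W^\vee\to\bigoplus_{\rho_i}\mathcal O_{X_\beta}(D_{\rho_i})$,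 with cokernel $\mathcal E_\beta$. If $\mathcal E$ is locally free, then $\hat F$ is injective, i.e. $$0\to\mathcal O_{X_\beta}\otimes W^\vee\xrightarrow{\;\hat F\;}\bigoplus_{\rho_i}\mathcal O_{X_\beta}(D_{\rho_i})\to\mathcal E_\beta\to0$$ is exact, and $\mathcal E_\beta$ is locally free. -/

import Mathlib

open CategoryTheory TopologicalSpace Opposite
open scoped TensorProduct

noncomputable section

/-! ## Quotients of quasi-affine varieties by diagonalizable groups

`deg : ι → A` is a grading of the polynomial ring `ℂ[x_i | i ∈ ι]` by an abelian group `A`, and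
`Z ⊆ ℂ^ι`.  The group `G = Hom(A, ℂˣ)` acts on `ℂ^ι` by `(g • x)_i = g(deg i) x_i`, and we form
`(ℂ^ι - Z) / G` as a ringed space, together with the sheaves of equivariant regular functions. -/

namespace Cox

/-- The points of `ℂ^ι - Z`. -/
structure Cover {ι : Type} (Z : Set (ι → ℂ)) : Type where
  /-- the coordinates of the point -/
  pt : ι → ℂ
  notMem : pt ∉ Z

/-- The Zariski topology on `ℂ^ι - Z`: the sets `{p ≠ 0}` form a basis. -/
instance Cover.topology {ι : Type} (Z : Set (ι → ℂ)) : TopologicalSpace (Cover Z) :=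
  TopologicalSpace.generateFrom
    (Set.range fun p : MvPolynomial ι ℂ => {x : Cover Z | MvPolynomial.eval x.pt p ≠ 0})

/-- The group `G = Hom(A, ℂˣ)`. -/
abbrev Grp (A : Type) [AddCommGroup A] : Type := Multiplicative A →* ℂˣ

/-- The value of the character of `G = Hom(A, ℂˣ)` given by `a : A`. -/
def character {A : Type} [AddCommGroup A] (a : A) (g : Grp A) : ℂ :=
  (g (Multiplicative.ofAdd a) : ℂˣ)

section Quotient

variable {ι A : Type} [AddCommGroup A] (deg : ι → A) (Z : Set (ι → ℂ))

/-- The action of `G` on `ℂ^ι`. -/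
def act (g : Grp A) (x : ι → ℂ) : ι → ℂ := fun i => character (deg i) g * x i

/-- Two points of `ℂ^ι - Z` are equivalent if they lie in the same `G`-orbit. -/
def orbitSetoid : Setoid (Cover Z) where
  r x y := ∃ g : Grp A, y.pt = act deg g x.pt
  iseqv :=
    { refl := fun x => ⟨1, by ext i; simp [act, character]⟩
      symm := by
        rintro x y ⟨g, h⟩
        refine ⟨g⁻¹, ?_⟩
        ext i
        simp [act, character, h]
      trans := by
        rintro x y z ⟨g, h⟩ ⟨g', h'⟩
        refine ⟨g' * g, ?_⟩
        ext i
        simp [act, character, h, h', mul_assoc] }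

/-- The space `(ℂ^ι - Z) / G`, with the quotient of the Zariski topology. -/
def Space : TopCat := TopCat.of (Quotient (orbitSetoid deg Z))

/-- The quotient map. -/
def proj (x : Cover Z) : Space deg Z := Quotient.mk (orbitSetoid deg Z) x

lemma continuous_proj : Continuous (proj deg Z) := continuous_quotient_mk'

/-- The inverse image in `ℂ^ι - Z` of an open subset of the quotient. -/
def preim (U : Opens (Space deg Z)) : Set (Cover Z) := proj deg Z ⁻¹' U

end Quotient

/-- A function on a subset `Y` of `ℂ^ι - Z` is regular if locally it is a quotient of
polynomials. -/
def IsRegular {ι : Type} {Z : Set (ι → ℂ)} (Y : Set (Cover Z)) (s : Y → ℂ) : Prop :=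
  ∀ x : Y, ∃ O : Set (Cover Z), IsOpen O ∧ x.1 ∈ O ∧ ∃ p q : MvPolynomial ι ℂ,
    ∀ y : Y, y.1 ∈ O → MvPolynomial.eval y.1.pt q ≠ 0 ∧
      s y = MvPolynomial.eval y.1.pt p / MvPolynomial.eval y.1.pt q

section Regular

variable {ι : Type} {Z : Set (ι → ℂ)} {Y : Set (Cover Z)}

lemma IsRegular.of_eval (p : MvPolynomial ι ℂ) :
    IsRegular Y (fun x => MvPolynomial.eval x.1.pt p) :=
  fun _ => ⟨Set.univ, isOpen_univ, trivial, p, 1, fun y _ => by simp⟩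

lemma IsRegular.const (c : ℂ) : IsRegular Y (fun _ => c) := by
  simpa using IsRegular.of_eval (Y := Y) (MvPolynomial.C c)

lemma IsRegular.add {s t : Y → ℂ} (hs : IsRegular Y s) (ht : IsRegular Y t) :
    IsRegular Y (fun x => s x + t x) := by
  intro x
  obtain ⟨O, hO, hx, p, q, h⟩ := hs x
  obtain ⟨O', hO', hx', p', q', h'⟩ := ht x
  refine ⟨O ∩ O', hO.inter hO', ⟨hx, hx'⟩, p * q' + q * p', q * q', fun y hy => ?_⟩
  obtain ⟨h1, h2⟩ := h y hy.1
  obtain ⟨h3, h4⟩ := h' y hy.2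
  refine ⟨by simpa using ⟨h1, h3⟩, ?_⟩
  simp only [h2, h4]
  rw [div_add_div _ _ h1 h3]
  simp

lemma IsRegular.mul {s t : Y → ℂ} (hs : IsRegular Y s) (ht : IsRegular Y t) :
    IsRegular Y (fun x => s x * t x) := by
  intro x
  obtain ⟨O, hO, hx, p, q, h⟩ := hs x
  obtain ⟨O', hO', hx', p', q', h'⟩ := ht x
  refine ⟨O ∩ O', hO.inter hO', ⟨hx, hx'⟩, p * p', q * q', fun y hy => ?_⟩
  obtain ⟨h1, h2⟩ := h y hy.1
  obtain ⟨h3, h4⟩ := h' y hy.2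
  refine ⟨by simpa using ⟨h1, h3⟩, ?_⟩
  simp only [h2, h4]
  rw [div_mul_div_comm]
  simp

lemma IsRegular.sum {I : Type} (S : Finset I) (F : I → Y → ℂ) (h : ∀ i, IsRegular Y (F i)) :
    IsRegular Y (fun x => ∑ i ∈ S, F i x) := by
  classical
  induction S using Finset.induction_on with
  | empty => simpa using IsRegular.const 0
  | insert i S hi ih => simpa [Finset.sum_insert hi] using (h i).add ih

lemma IsRegular.neg {s : Y → ℂ} (hs : IsRegular Y s) : IsRegular Y (fun x => - s x) := by
  simpa using (IsRegular.const (Y := Y) (-1)).mul hs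

lemma IsRegular.restrict {Y' : Set (Cover Z)} (hY : Y' ⊆ Y) {s : Y → ℂ} (hs : IsRegular Y s) :
    IsRegular Y' (fun x => s ⟨x.1, hY x.2⟩) := by
  intro x
  obtain ⟨O, hO, hx, p, q, h⟩ := hs ⟨x.1, hY x.2⟩
  exact ⟨O, hO, hx, p, q, fun y hy => h ⟨y.1, hY y.2⟩ hy⟩

end Regular

section Sheaves

variable {ι A : Type} [AddCommGroup A] (deg : ι → A) (Z : Set (ι → ℂ))

/-- The sections over `U` of the sheaf attached to a representation `V` of `G`: the
`G`-equivariant functions from the inverse image of `U` to `V` that are regular, i.e. whose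
composite with every linear functional on `V` is regular. -/
structure IsSection {V : Type} [AddCommGroup V] [Module ℂ V] (r : Representation ℂ (Grp A) V)
    (U : Opens (Space deg Z)) (s : preim deg Z U → V) : Prop where
  regular : ∀ l : Module.Dual ℂ V, IsRegular (preim deg Z U) (fun x => l (s x))
  equivariant : ∀ (g : Grp A) (x y : preim deg Z U), y.1.pt = act deg g x.1.pt → s y = r g (s x)

/-- The ring of regular functions on `U`: the regular `G`-invariant functions on its inverse
image. -/
def functionRing (U : Opens (Space deg Z)) : Subring (preim deg Z U → ℂ) where
  carrier := {s | IsRegular (preim deg Z U) s ∧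
    ∀ (g : Grp A) (x y : preim deg Z U), y.1.pt = act deg g x.1.pt → s y = s x}
  mul_mem' := fun ha hb => ⟨ha.1.mul hb.1, fun g x y h => by
    simp [ha.2 g x y h, hb.2 g x y h]⟩
  one_mem' := ⟨IsRegular.const 1, fun _ _ _ _ => rfl⟩
  add_mem' := fun ha hb => ⟨ha.1.add hb.1, fun g x y h => by
    simp [ha.2 g x y h, hb.2 g x y h]⟩
  zero_mem' := ⟨IsRegular.const 0, fun _ _ _ _ => rfl⟩
  neg_mem' := fun ha => ⟨ha.1.neg, fun g x y h => by simp [ha.2 g x y h]⟩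

lemma preim_mono {U U' : Opens (Space deg Z)} (h : U' ≤ U) : preim deg Z U' ⊆ preim deg Z U :=
  fun _ hx => h hx

/-- Restriction of regular functions. -/
def restrictRing {U U' : Opens (Space deg Z)} (h : U' ≤ U) :
    functionRing deg Z U →+* functionRing deg Z U' where
  toFun s := ⟨fun x => s.1 ⟨x.1, preim_mono deg Z h x.2⟩,
    s.2.1.restrict (preim_mono deg Z h), fun g _ _ hxy => s.2.2 g _ _ hxy⟩
  map_one' := rfl
  map_mul' _ _ := rfl
  map_zero' := rfl
  map_add' _ _ := rfl

/-- The presheaf of rings of regular functions. -/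
def structurePresheaf : (Opens (Space deg Z))ᵒᵖ ⥤ RingCat where
  obj U := RingCat.of (functionRing deg Z U.unop)
  map f := RingCat.ofHom (restrictRing deg Z f.unop.le)

variable {V : Type} [AddCommGroup V] [Module ℂ V] (r : Representation ℂ (Grp A) V)

/-- The module of sections over `U` of the sheaf attached to the representation `r`. -/
def sectionModule (U : Opens (Space deg Z)) :
    Submodule (functionRing deg Z U) (preim deg Z U → V) where
  carrier := {s | IsSection deg Z r U s}
  add_mem' := fun ha hb => ⟨fun l => by simpa using (ha.1 l).add (hb.1 l), fun g x y h => by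
    simp [ha.2 g x y h, hb.2 g x y h]⟩
  zero_mem' := ⟨fun l => by simpa using IsRegular.const 0, fun g x y h => by simp⟩
  smul_mem' := fun c s hs => ⟨fun l => by
    have : (fun x => l ((c • s) x)) = fun x => c.1 x * l (s x) := by
      ext x
      exact (l.map_smul (c.1 x) (s x))
    rw [this]
    exact c.2.1.mul (hs.1 l), fun g x y h => by
      change c.1 y • s y = r g (c.1 x • s x)
      rw [c.2.2 g x y h, hs.2 g x y h, map_smul]⟩

/-- Restriction of sections. -/
def restrictSection {U U' : Opens (Space deg Z)} (h : U' ≤ U) :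
    sectionModule deg Z r U →+ sectionModule deg Z r U' where
  toFun s := ⟨fun x => s.1 ⟨x.1, preim_mono deg Z h x.2⟩,
    fun l => (s.2.1 l).restrict (preim_mono deg Z h), fun g _ _ hxy => s.2.2 g _ _ hxy⟩
  map_zero' := rfl
  map_add' _ _ := rfl

/-- The presheaf of abelian groups of sections. -/
def sectionPresheaf : (Opens (Space deg Z))ᵒᵖ ⥤ AddCommGrpCat where
  obj U := AddCommGrpCat.of (sectionModule deg Z r U.unop)
  map f := AddCommGrpCat.ofHom (restrictSection deg Z r f.unop.le)

section Gluing

variable {deg Z} {I : Type} {U : I → Opens (Space deg Z)}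

lemma preim_le_iSup (i : I) : preim deg Z (U i) ⊆ preim deg Z (iSup U) :=
  preim_mono deg Z (le_iSup U i)

lemma exists_mem_preim {x : Cover Z} (hx : x ∈ preim deg Z (iSup U)) :
    ∃ i, x ∈ preim deg Z (U i) := by
  have h : proj deg Z x ∈ iSup U := hx
  exact Opens.mem_iSup.1 h

lemma exists_glue {T : Type} (sf : ∀ i, preim deg Z (U i) → T)
    (h : ∀ i j x (hi : x ∈ preim deg Z (U i)) (hj : x ∈ preim deg Z (U j)),
      sf i ⟨x, hi⟩ = sf j ⟨x, hj⟩) :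
    ∃ s : preim deg Z (iSup U) → T, ∀ i x (hi : x ∈ preim deg Z (U i)),
      s ⟨x, preim_le_iSup i hi⟩ = sf i ⟨x, hi⟩ :=
  ⟨fun x => sf (exists_mem_preim x.2).choose ⟨x.1, (exists_mem_preim x.2).choose_spec⟩,
    fun _ _ _ => h _ _ _ _ _⟩

lemma isRegular_of_local (s : preim deg Z (iSup U) → ℂ)
    (h : ∀ i, IsRegular (preim deg Z (U i)) (fun x => s ⟨x.1, preim_le_iSup i x.2⟩)) :
    IsRegular (preim deg Z (iSup U)) s := by
  intro x
  obtain ⟨i, hi⟩ := exists_mem_preim x.2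
  obtain ⟨O, hO, hx, p, q, hpq⟩ := h i ⟨x.1, hi⟩
  exact ⟨O ∩ preim deg Z (U i), hO.inter ((U i).2.preimage (continuous_proj deg Z)), ⟨hx, hi⟩, p, q,
    fun y hy => hpq ⟨y.1, hy.2⟩ hy.1⟩

lemma mem_preim_of_act {U : Opens (Space deg Z)} {g : Grp A} {x y : Cover Z}
    (h : y.pt = act deg g x.pt) (hx : x ∈ preim deg Z U) : y ∈ preim deg Z U := by
  have : proj deg Z x = proj deg Z y := Quotient.sound ⟨g, h⟩
  change proj deg Z y ∈ U
  rw [← this]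
  exact hx

lemma isSection_of_local (s : preim deg Z (iSup U) → V)
    (h : ∀ i, IsSection deg Z r (U i) (fun x => s ⟨x.1, preim_le_iSup i x.2⟩)) :
    IsSection deg Z r (iSup U) s where
  regular l := isRegular_of_local _ fun i => (h i).regular l
  equivariant g x y hxy := by
    obtain ⟨i, hi⟩ := exists_mem_preim x.2
    exact (h i).equivariant g ⟨x.1, hi⟩ ⟨y.1, mem_preim_of_act hxy hi⟩ hxy

end Gluing

lemma structurePresheaf_isSheaf : TopCat.Presheaf.IsSheaf (structurePresheaf deg Z) := by
  rw [TopCat.Presheaf.isSheaf_iff_isSheafUniqueGluing]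
  intro I U sf hsf
  obtain ⟨s, hs⟩ := exists_glue (fun i => (show functionRing deg Z (U i) from sf i).1)
    (fun i j x hi hj => congrFun (congrArg Subtype.val (hsf i j)) ⟨x, hi, hj⟩)
  have hs' : ∀ i, (fun x : preim deg Z (U i) => s ⟨x.1, preim_le_iSup i x.2⟩) =
      (show functionRing deg Z (U i) from sf i).1 := fun i => funext fun x => hs i x.1 x.2
  refine ⟨⟨s, isRegular_of_local _ fun i => ?_, fun g x y hxy => ?_⟩, fun i => ?_, ?_⟩
  · rw [hs' i]
    exact (show functionRing deg Z (U i) from sf i).2.1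
  · obtain ⟨i, hi⟩ := exists_mem_preim x.2
    have hy := mem_preim_of_act hxy hi
    rw [hs i x.1 hi, hs i y.1 hy]
    exact (show functionRing deg Z (U i) from sf i).2.2 g ⟨x.1, hi⟩ ⟨y.1, hy⟩ hxy
  · exact Subtype.ext (hs' i)
  · intro t ht
    refine Subtype.ext (funext fun x => ?_)
    obtain ⟨i, hi⟩ := exists_mem_preim x.2
    exact (congrFun (congrArg Subtype.val (ht i)) ⟨x.1, hi⟩).trans (hs i x.1 hi).symm

lemma sectionPresheaf_isSheaf : TopCat.Presheaf.IsSheaf (sectionPresheaf deg Z r) := by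
  rw [TopCat.Presheaf.isSheaf_iff_isSheafUniqueGluing]
  intro I U sf hsf
  obtain ⟨s, hs⟩ := exists_glue (fun i => (show sectionModule deg Z r (U i) from sf i).1)
    (fun i j x hi hj => congrFun (congrArg Subtype.val (hsf i j)) ⟨x, hi, hj⟩)
  have hs' : ∀ i, (fun x : preim deg Z (U i) => s ⟨x.1, preim_le_iSup i x.2⟩) =
      (show sectionModule deg Z r (U i) from sf i).1 := fun i => funext fun x => hs i x.1 x.2
  refine ⟨⟨s, isSection_of_local r _ fun i => ?_⟩, fun i => ?_, ?_⟩
  · rw [hs' i]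
    exact (show sectionModule deg Z r (U i) from sf i).2
  · exact Subtype.ext (hs' i)
  · intro t ht
    refine Subtype.ext (funext fun x => ?_)
    obtain ⟨i, hi⟩ := exists_mem_preim x.2
    exact (congrFun (congrArg Subtype.val (ht i)) ⟨x.1, hi⟩).trans (hs i x.1 hi).symm

/-- The structure sheaf of `(ℂ^ι - Z) / G`. -/
abbrev structureSheaf : Sheaf (Opens.grothendieckTopology (Space deg Z)) RingCat :=
  ⟨structurePresheaf deg Z, structurePresheaf_isSheaf deg Z⟩

instance (U : (Opens (Space deg Z))ᵒᵖ) :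
    Module ((structurePresheaf deg Z).obj U) ((sectionPresheaf deg Z r).obj U) :=
  inferInstanceAs (Module (functionRing deg Z U.unop) (sectionModule deg Z r U.unop))

/-- The sheaf of modules on `(ℂ^ι - Z) / G` attached to a representation of `G`: its sections over
`U` are the regular `G`-equivariant functions on the inverse image of `U`. -/
def sheafOf : SheafOfModules (structureSheaf deg Z) where
  val := PresheafOfModules.ofPresheaf (R := structurePresheaf deg Z) (sectionPresheaf deg Z r)
    (fun _ _ _ _ _ => rfl)
  isSheaf := sectionPresheaf_isSheaf deg Z r

end Sheaves

section Euler

variable {ι A : Type} [AddCommGroup A] (deg : ι → A) (Z : Set (ι → ℂ))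

/-- The representation of `G` on `ℂ^ι` through which `G` acts on the coordinates. Its sheaf is the
direct sum of the sheaves `O(D_i)`, `i ∈ ι`, where `D_i = {x_i = 0}`: the sections of `O(D_i)` are
the regular functions `s` with `s(g • x) = g(deg i) s(x)`. -/
def coordRep : Representation ℂ (Grp A) (ι → ℂ) where
  toFun g := LinearMap.pi fun i => character (deg i) g • LinearMap.proj i
  map_one' := by
    ext
    simp [character]
  map_mul' g h := by
    ext
    simp [character, mul_assoc]

variable (A) in
/-- The complex vector space `W = A ⊗ ℂ`. -/
abbrev WSpace : Type := ℂ ⊗[ℤ] A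

/-- The homogeneous polynomials of degree `a`. -/
abbrev Homog (a : A) : Submodule ℂ (MvPolynomial ι ℂ) :=
  MvPolynomial.weightedHomogeneousSubmodule ℂ deg a

/-- The value at `x` of a `W`-valued homogeneous polynomial. -/
def evalW (x : ι → ℂ) {a : A} : (Homog deg a ⊗[ℂ] WSpace A) →ₗ[ℂ] WSpace A :=
  (TensorProduct.lid ℂ (WSpace A)).toLinearMap ∘ₗ
    LinearMap.rTensor (WSpace A) ((MvPolynomial.aeval x).toLinearMap ∘ₗ (Homog deg a).subtype)

/-- The sheaf `O ⊗ W^∨`, i.e. the sheaf of regular functions with values in `W^∨`. -/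
def dualWSheaf : SheafOfModules (structureSheaf deg Z) :=
  sheafOf deg Z (Representation.trivial ℂ (Grp A) (Module.Dual ℂ (WSpace A)))

/-- The sheaf `⨁ i, O(D_i)`. -/
def divisorSheaf : SheafOfModules (structureSheaf deg Z) :=
  sheafOf deg Z (coordRep deg)

variable {deg Z}

lemma eval_act {a : A} {p : MvPolynomial ι ℂ} (hp : p ∈ Homog deg a) (g : Grp A) (x : ι → ℂ) :
    MvPolynomial.aeval (act deg g x) p = character a g * MvPolynomial.aeval x p := by
  have key : ∀ d : ι →₀ ℕ, character (Finsupp.weight deg d) g = d.prod fun i k => character (deg i) g ^ k := by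
    intro d
    simp [character, Finsupp.weight_apply, Finsupp.sum, Finsupp.prod, ofAdd_sum, map_prod, ofAdd_nsmul]
  rw [MvPolynomial.aeval_def, MvPolynomial.aeval_def, MvPolynomial.eval₂_eq, MvPolynomial.eval₂_eq, Finset.mul_sum]
  refine Finset.sum_congr rfl fun d hd => ?_
  have hw := hp (MvPolynomial.mem_support_iff.1 hd)
  rw [← hw, key]
  simp only [act, mul_pow, Finset.prod_mul_distrib, Finsupp.prod]
  ring

lemma evalW_act {a : A} (e : Homog deg a ⊗[ℂ] WSpace A) (g : Grp A) (x : ι → ℂ) :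
    evalW deg (act deg g x) e = character a g • evalW deg x e := by
  induction e with
  | zero => simp
  | add e f he hf => simp [he, hf]
  | tmul p w =>
    have := eval_act p.2 g x
    simp only [evalW, LinearMap.comp_apply, LinearMap.rTensor_tmul, Submodule.subtype_apply,
      AlgHom.toLinearMap_apply, LinearEquiv.coe_coe, TensorProduct.lid_tmul, this, mul_smul]

lemma isRegular_pairing {Y : Set (Cover Z)} {s : Y → Module.Dual ℂ (WSpace A)}
    (hs : ∀ l : Module.Dual ℂ (Module.Dual ℂ (WSpace A)), IsRegular Y (fun x => l (s x)))
    {a : A} (e : Homog deg a ⊗[ℂ] WSpace A) :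
    IsRegular Y (fun x => s x (evalW deg x.1.pt e)) := by
  induction e with
  | zero => simpa using IsRegular.const 0
  | add e f he hf => simpa using he.add hf
  | tmul p w =>
    simpa [evalW, MvPolynomial.aeval_def, MvPolynomial.eval₂_eq_eval_map] using
      (IsRegular.of_eval p.1).mul (hs (Module.Dual.eval ℂ (WSpace A) w))

variable [Finite ι]

lemma isSection_pairing {U : Opens (Space deg Z)} {s : preim deg Z U → Module.Dual ℂ (WSpace A)}
    (hs : IsSection deg Z (Representation.trivial ℂ (Grp A) (Module.Dual ℂ (WSpace A))) U s)
    (E : ∀ i, Homog deg (deg i) ⊗[ℂ] WSpace A) :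
    IsSection deg Z (coordRep deg) U (fun x i => s x (evalW deg x.1.pt (E i))) where
  regular l := by
    have := Fintype.ofFinite ι
    classical
    have hl : ∀ u : ι → ℂ, l u = ∑ i, l (Pi.single i 1) * u i := by
      intro u
      conv_lhs => rw [pi_eq_sum_univ u]
      simp only [map_sum, map_smul, smul_eq_mul]
      refine Finset.sum_congr rfl fun i _ => ?_
      rw [mul_comm]
      congr 2
      ext j
      simp [Pi.single_apply, eq_comm]
    have hl' : (fun x : preim deg Z U => l (fun i => s x (evalW deg x.1.pt (E i)))) =
        fun x => ∑ i, l (Pi.single i 1) * s x (evalW deg x.1.pt (E i)) := funext fun x => hl _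
    rw [hl']
    exact IsRegular.sum _ _ fun i => (IsRegular.const _).mul (isRegular_pairing hs.regular (E i))
  equivariant g x y h := by
    ext i
    simp [hs.equivariant g x y h, h, evalW_act, coordRep]

variable (deg Z)

/-- The morphism `O ⊗ W^∨ → ⨁ i, O(D_i)` given by `W`-valued sections `E_i` of the sheaves
`O(D_i)`: it sends `φ` to `(⟨φ, E_i⟩)_i`. -/
def eulerMap (E : ∀ i, Homog deg (deg i) ⊗[ℂ] WSpace A) : dualWSheaf deg Z ⟶ divisorSheaf deg Z where
  val := PresheafOfModules.homMk
    { app := fun _ => AddCommGrpCat.ofHom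
        { toFun := fun s => ⟨fun x i => s.1 x (evalW deg x.1.pt (E i)), isSection_pairing s.2 E⟩
          map_zero' := rfl
          map_add' := fun _ _ => rfl }
      naturality := fun _ _ _ => rfl }
    (fun _ _ _ => rfl)

/-- The sheaf `𝓔` defined by `O ⊗ W^∨ → ⨁ i, O(D_i) → 𝓔 → 0`. -/
def eulerCokernel (E : ∀ i, Homog deg (deg i) ⊗[ℂ] WSpace A) :
    SheafOfModules (structureSheaf deg Z) :=
  Limits.cokernel (eulerMap deg Z E)

end Euler
end Cox

/-! ## Coefficients of polynomials after a substitution -/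

/-- `P` has coefficients homogeneous of degree `a`. -/
def CoeffHomog {σ τ A : Type} [AddCommGroup A] (w : τ → A) (a : A)
    (P : MvPolynomial σ (MvPolynomial τ ℂ)) : Prop :=
  ∀ m, (P.coeff m).IsWeightedHomogeneous w a

section CoeffHomog

variable {σ τ A : Type} [AddCommGroup A] {w : τ → A}  {a b : A}
    {P Q : MvPolynomial σ (MvPolynomial τ ℂ)}

lemma CoeffHomog.mul (hP : CoeffHomog w a P) (hQ : CoeffHomog w b Q) : CoeffHomog w (a + b) (P * Q) := by
  classical
  intro m
  rw [MvPolynomial.coeff_mul]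
  exact MvPolynomial.IsWeightedHomogeneous.sum _ _ _ fun x _ => (hP x.1).mul (hQ x.2)

lemma CoeffHomog.C {p : MvPolynomial τ ℂ} (hp : p.IsWeightedHomogeneous w a) :
   CoeffHomog w a (MvPolynomial.C p : MvPolynomial σ (MvPolynomial τ ℂ)) := by
  classical
  intro m
  rw [MvPolynomial.coeff_C]
  split_ifs
  · exact hp
  · exact MvPolynomial.isWeightedHomogeneous_zero _ _ _

lemma CoeffHomog.pow (hP : CoeffHomog w a P) (n : ℕ) : CoeffHomog w (n • a) (P ^ n) := by
  induction n with
  | zero => simpa using CoeffHomog.C (MvPolynomial.isWeightedHomogeneous_one ℂ w)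
  | succ n ih => simpa [pow_succ, succ_nsmul] using ih.mul hP

lemma CoeffHomog.sum {I : Type} (s : Finset I) (F : I → MvPolynomial σ (MvPolynomial τ ℂ))
    (h : ∀ i ∈ s, CoeffHomog w a (F i)) : CoeffHomog w a (∑ i ∈ s, F i) := by
  intro m
  rw [MvPolynomial.coeff_sum]
  exact MvPolynomial.IsWeightedHomogeneous.sum _ _ _ fun i hi => h i hi m

lemma CoeffHomog.prod {I : Type} (s : Finset I) (F : I → MvPolynomial σ (MvPolynomial τ ℂ))
    (c : I → A) (h : ∀ i ∈ s, CoeffHomog w (c i) (F i)) :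
    CoeffHomog w (∑ i ∈ s, c i) (∏ i ∈ s, F i) := by
  classical
  induction s using Finset.induction_on with
  | empty => simpa using CoeffHomog.C (MvPolynomial.isWeightedHomogeneous_one ℂ w)
  | insert i s hi ih =>
    rw [Finset.sum_insert hi, Finset.prod_insert hi]
    exact (h i (by simp)).mul (ih fun j hj => h j (by simp [hj]))

/-- Substituting polynomials with coefficients of the right degrees preserves degrees. -/
lemma CoeffHomog.aeval {ι : Type} {deg : ι → A} {F : ι → MvPolynomial σ (MvPolynomial τ ℂ)}
    (hF : ∀ i, CoeffHomog w (deg i) (F i)) {p : MvPolynomial ι ℂ}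
    (hp : p ∈ MvPolynomial.weightedHomogeneousSubmodule ℂ deg a) :
    CoeffHomog w a (MvPolynomial.aeval F p) := by
  rw [MvPolynomial.aeval_def, MvPolynomial.eval₂_eq]
  refine CoeffHomog.sum _ _ fun d hd => ?_
  have h1 := CoeffHomog.prod d.support (fun i => F i ^ d i) (fun i => d i • deg i)
    fun i _ => (hF i).pow (d i)
  have h2 : ∑ i ∈ d.support, d i • deg i = a := by
    rw [← hp (MvPolynomial.mem_support_iff.1 hd), Finsupp.weight_apply, Finsupp.sum]
  rw [h2] at h1
  have h3 : CoeffHomog w 0 (algebraMap ℂ (MvPolynomial σ (MvPolynomial τ ℂ)) (p.coeff d)) :=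
    CoeffHomog.C (MvPolynomial.isWeightedHomogeneous_C w _)
  simpa using h3.mul h1

lemma CoeffHomog.X (j : σ) : CoeffHomog w 0 (MvPolynomial.X j : MvPolynomial σ (MvPolynomial τ ℂ)) := by
  classical
  intro m
  rw [MvPolynomial.coeff_X]
  split_ifs
  · exact MvPolynomial.isWeightedHomogeneous_one ℂ w
  · exact MvPolynomial.isWeightedHomogeneous_zero _ _ _

end CoeffHomog

/-! ## Smooth projective toric varieties -/

/-- The cone in `ℝⁿ` spanned by the vectors `gen ρ`, `ρ ∈ σ`. -/
def coneHull {n : ℕ} {R : Type} [Fintype R] (gen : R → Fin n → ℤ) (σ : Finset R) :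
    Set (Fin n → ℝ) :=
  {y | ∃ c : R → ℝ, (∀ ρ, 0 ≤ c ρ) ∧ (∀ ρ, ρ ∉ σ → c ρ = 0) ∧ ∀ j, y j = ∑ ρ, c ρ * gen ρ j}

/-- The fan of a smooth projective toric variety, in the lattice `N = ℤⁿ`. The type `R` is the set
of its one-dimensional cones. As the cones of a smooth fan are simplicial, each of them is given by
the set of its edges. -/
structure SmoothProjectiveFan (n : ℕ) (R : Type) [Fintype R] [DecidableEq R] where
  /-- the minimal generators of the one-dimensional cones -/
  gen : R → Fin n → ℤ
  /-- the sets of edges of the cones of the fan -/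
  cones : Set (Finset R)
  /-- the zero cone belongs to the fan -/
  empty_mem : ∅ ∈ cones
  /-- each `ρ` belongs to the fan -/
  singleton_mem : ∀ ρ, {ρ} ∈ cones
  /-- the faces of a cone of the fan belong to the fan -/
  face_mem : ∀ σ ∈ cones, ∀ τ ⊆ σ, τ ∈ cones
  /-- two cones meet along their common face -/
  inter : ∀ σ ∈ cones, ∀ τ ∈ cones, coneHull gen σ ∩ coneHull gen τ = coneHull gen (σ ∩ τ)
  /-- smoothness: the generators of a cone are part of a basis of the lattice -/
  smooth : ∀ σ ∈ cones, ∃ b : Module.Basis (Fin n) ℤ (Fin n → ℤ), ∀ ρ ∈ σ, ∃ j, b j = gen ρ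
  /-- completeness: the support of the fan is all of `ℝⁿ` -/
  complete : ∀ y : Fin n → ℝ, ∃ σ ∈ cones, y ∈ coneHull gen σ
  /-- projectivity: there is an ample divisor `∑ ρ, a ρ • D ρ`, i.e. one whose support function is
  strictly convex -/
  projective : ∃ a : R → ℤ, ∀ σ ∈ cones, σ.card = n → ∃ m : Fin n → ℤ,
    (∀ ρ ∈ σ, m ⬝ᵥ gen ρ = - a ρ) ∧ ∀ ρ, ρ ∉ σ → - a ρ < m ⬝ᵥ gen ρ

namespace SmoothProjectiveFan

variable {n : ℕ} {R : Type} [Fintype R] [DecidableEq R] (F : SmoothProjectiveFan n R)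

/-- The map `M → ℤ^R`, `m ↦ (⟨m, v_ρ⟩)_ρ`. -/
def charDivisor : (Fin n → ℤ) →ₗ[ℤ] (R → ℤ) := (Matrix.of F.gen).mulVecLin

/-- The Picard group of `X`, the cokernel of `M → ℤ^R`. -/
abbrev Pic : Type := (R → ℤ) ⧸ LinearMap.range F.charDivisor

/-- The class `[D_ρ]`. -/
def divClass (ρ : R) : F.Pic := Submodule.Quotient.mk (Pi.single ρ 1)

/-- The vanishing locus `Z(Σ)` of the irrelevant ideal, which is generated by the monomials
`∏_{ρ ∉ σ} x_ρ`. The toric variety is `X = (ℂ^R - Z(Σ)) / Hom(Pic X, ℂˣ)`. -/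
def irrelevantLocus : Set (R → ℂ) := {x | ∀ σ ∈ F.cones, ∏ ρ ∈ σᶜ, x ρ = 0}

/-! ### The moduli space `X_β` -/

/-- A class `β ∈ H_2(X, ℤ) = Hom(Pic X, ℤ)`, given by its intersection numbers with divisors. -/
abbrev CurveClass : Type := F.Pic →+ ℤ

variable (β : F.CurveClass)

/-- The intersection number `d_ρ = D_ρ · β`. -/
def deg (ρ : R) : ℤ := β (F.divClass ρ)

/-- `h⁰(ℙ¹, O(d_ρ)) = max(0, d_ρ + 1)`. -/
def sectionCount (ρ : R) : ℕ := (F.deg β ρ + 1).toNat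

/-- The symbols `ρ_i`, where `0 ≤ i ≤ d_ρ`. They index the coordinates `f_{ρ_i}` on
`ℂ_β = ⨁_ρ H⁰(ℙ¹, O(d_ρ))`. -/
abbrev EdgeSymbol : Type := Σ ρ : R, Fin (F.sectionCount β ρ)

/-- The degree of `f_{ρ_i}` is `[D_ρ]`. -/
def edgeClass (k : F.EdgeSymbol β) : F.Pic := F.divClass k.1

/-- The value at `(t₀, t₁)` of the map `ℂ² → ℂ^R` given by a point `f` of `ℂ_β`: its components
are `f_ρ(t) = ∑_i f_{ρ_i} t₀^i t₁^(d_ρ - i)`. -/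
def mapAt (f : F.EdgeSymbol β → ℂ) (t₀ t₁ : ℂ) : R → ℂ :=
  fun ρ => ∑ i : Fin (F.sectionCount β ρ),
    f ⟨ρ, i⟩ * t₀ ^ (i : ℕ) * t₁ ^ ((F.deg β ρ).toNat - (i : ℕ))

/-- The set `Z_β` of the `f ∈ ℂ_β` defining a map whose image is contained in `Z(Σ)`. The moduli
space is `X_β = (ℂ_β - Z_β) / Hom(Pic X, ℂˣ)`. -/
def badMaps : Set (F.EdgeSymbol β → ℂ) := {f | ∀ t₀ t₁ : ℂ, F.mapAt β f t₀ t₁ ∈ F.irrelevantLocus}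

/-! ### The induced sections -/

/-- `f_ρ(t) = ∑_i f_{ρ_i} t₀^i t₁^(d_ρ - i)` as a polynomial in `t₀, t₁` whose coefficients are
polynomials in the `f_{ρ_i}`. -/
def genericSection (ρ : R) : MvPolynomial (Fin 2) (MvPolynomial (F.EdgeSymbol β) ℂ) :=
  ∑ i : Fin (F.sectionCount β ρ), MvPolynomial.C (MvPolynomial.X ⟨ρ, i⟩) *
    MvPolynomial.X 0 ^ (i : ℕ) * MvPolynomial.X 1 ^ ((F.deg β ρ).toNat - (i : ℕ))

lemma genericSection_coeffHomog (ρ : R) :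
    CoeffHomog (F.edgeClass β) (F.divClass ρ) (F.genericSection β ρ) := by
  refine CoeffHomog.sum _ _ fun i _ => ?_
  have h := ((CoeffHomog.C (σ := Fin 2) (MvPolynomial.isWeightedHomogeneous_X ℂ (F.edgeClass β)
    (⟨ρ, i⟩ : F.EdgeSymbol β))).mul ((CoeffHomog.X 0).pow (i : ℕ))).mul
      ((CoeffHomog.X 1).pow ((F.deg β ρ).toNat - (i : ℕ)))
  simpa [edgeClass] using h

/-- The linear map sending a homogeneous polynomial `p(x)` to the coefficient of
`t₀^i t₁^(d_ρ - i)` in `p(f(t))`, where `k = ρ_i`. -/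
def coeffMap (k : F.EdgeSymbol β) :
    Cox.Homog F.divClass (F.divClass k.1) →ₗ[ℂ] Cox.Homog (F.edgeClass β) (F.edgeClass β k) where
  toFun p := ⟨MvPolynomial.coeff
      (Finsupp.single 0 (k.2 : ℕ) + Finsupp.single 1 ((F.deg β k.1).toNat - (k.2 : ℕ)))
      (MvPolynomial.aeval (F.genericSection β) p.1),
    CoeffHomog.aeval (F.genericSection_coeffHomog β) p.2 _⟩
  map_add' p q := by
    ext1
    simp
  map_smul' c p := by
    ext1
    simp

/-- The components `E_{ρ_i}` of the induced map: `E_ρ(f(t)) = ∑_i E_{ρ_i}(f) t₀^i t₁^(d_ρ - i)`. -/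
def inducedSections
    (E : ∀ ρ, Cox.Homog F.divClass (F.divClass ρ) ⊗[ℂ] Cox.WSpace F.Pic) (k : F.EdgeSymbol β) :
    Cox.Homog (F.edgeClass β) (F.edgeClass β k) ⊗[ℂ] Cox.WSpace F.Pic :=
  LinearMap.rTensor (Cox.WSpace F.Pic) (F.coeffMap β k) (E k.1)

end SmoothProjectiveFan

end

/-! Both conclusions are equivalent to a pointwise condition that passes easily from $X$ to
$X_\beta$: at every point of $\mathbb C^\iota - Z$ the values of the sections $E_i$ span $W$, that
is, $\varphi \mapsto (\varphi(E_i(x)))_i$ is injective on $W^\vee$ for every $x$.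

From sheaves to points (`span_evalW_eq_top`): suppose a nonzero functional $\varphi$ kills all
$E_i(p)$. In local trivializations of the $\mathcal O(D_i)$, the image of the constant section
$\varphi$ is $\sum a_i d_i$ with all $a_i(p) = 0$. If the map is a monomorphism with locally free
cokernel, then $\varphi$ itself is locally a combination $\sum a_i m_i$ of sections of $\mathcal O
\otimes W^\vee$ (`exists_eq_sum_smul`, an elementwise form of the fact that an extension by a
locally free sheaf stays exact on fibres). Evaluating at $p$ gives $\varphi = 0$.

From points to sheaves (`mono_eulerMap`, `isLocallyFree_eulerCokernel`): injectivity is checked on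
values. Near $p$, some of the $E_i$ form a basis of $W$; inverting their matrix gives a local
retraction of the map. Its kernel consists of the vectors whose coordinates at the chosen indices
vanish, and is free because each $\mathcal O(D_i)$ is locally trivial. So the sequence splits
locally with free cokernel.

From $X$ to $X_\beta$ (`span_evalW_inducedSections`): if $f \notin Z_\beta$, some $f(t)$ lies
outside $Z(\Sigma)$. Then $W$ is spanned by the $E_\rho(f(t))$, which are combinations of the
$E_{\rho_i}(f)$ with coefficients the monomials in $t$.

Both quotients have locally trivial $\mathcal O(D_i)$ because, by smoothness, the classes $[D_\rho]$
with $\rho$ outside a given cone generate $\mathrm{Pic}(X)$ (`exists_divClass_eq`). -/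

noncomputable section

/-! ### Subpresheaves of modules as local kernels -/

namespace PresheafOfModules
universe v u v' u'
variable {C : Type u'} [Category.{v'} C] {J : GrothendieckTopology C} {R : Sheaf J RingCat.{u}}

/-- The kernel of the quotient by a submodule. -/
lemma Submodule.cokernel_π_eq_zero_iff {S : Cᵒᵖ ⥤ RingCat.{u}} {M : PresheafOfModules.{v} S}
    (L : M.Submodule) (X : Cᵒᵖ) (m : M.obj X) :
    (Limits.cokernel.π L.ι).app X m = 0 ↔ m ∈ L.obj X := by
  -- Exactness at the middle term survives evaluation at `X`, which reduces the claim to modules.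
  have h : (ShortComplex.mk L.ι (Limits.cokernel.π L.ι) (by simp)).Exact :=
    ShortComplex.exact_cokernel L.ι
  have h' := (ShortComplex.moduleCat_exact_iff _).1 (h.map (evaluation S X))
  constructor
  · intro hm
    obtain ⟨l, hl⟩ := h' m hm
    have : m = l.1 := hl.symm
    rw [this]
    exact l.2
  · intro hm
    have := congrArg (fun φ => φ.app X (⟨m, hm⟩ : L.obj X)) (Limits.cokernel.condition L.ι)
    exact this

/-- A subpresheaf of modules of a sheaf of modules is locally the kernel of a morphism of
sheaves. -/
lemma Submodule.exists_hom_eq_zero_iff [J.WEqualsLocallyBijective AddCommGrpCat.{v}]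
    [HasWeakSheafify J AddCommGrpCat.{v}] {N : SheafOfModules.{v} R} (L : N.val.Submodule) :
    ∃ (T : SheafOfModules.{v} R) (g : N ⟶ T), ∀ (X : C) (n : N.val.obj (op X)),
      g.val.app (op X) n = 0 ↔ ∃ S ∈ J X, ∀ ⦃Y : C⦄ (f : Y ⟶ X), S.arrows f →
        N.val.restrictₛₗ f.op n ∈ L.obj (op Y) := by
  let Q := Limits.cokernel L.ι
  let adj := sheafificationAdjunction.{v} (𝟙 R.obj)
  let g : N ⟶ (sheafification (𝟙 R.obj)).obj Q :=
    -- The test morphism is the presheaf quotient followed by sheafification.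
    ⟨Limits.cokernel.π L.ι ≫ adj.unit.app Q⟩
  refine ⟨_, g, fun X n => ?_⟩
  let φ := CategoryTheory.toSheafify J Q.presheaf
  -- A section of the presheaf quotient that dies in the sheafification is already zero locally.
  have hφ : Presheaf.IsLocallyInjective J φ := inferInstance
  have key : ∀ (X : Cᵒᵖ) (n : N.val.obj X), g.val.app X n =
      φ.app X ((Limits.cokernel.π L.ι).app X n) := fun X n => rfl
  have hres : ∀ {Y : C} (f : Y ⟶ X), N.val.restrictₛₗ f.op n ∈ L.obj (op Y) ↔
      Q.map f.op ((Limits.cokernel.π L.ι).app _ n) = 0 := fun f => by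
    refine (L.cokernel_π_eq_zero_iff _ _).symm.trans ?_
    exact Eq.congr_left (naturality_apply (Limits.cokernel.π L.ι) f.op n)
  constructor
  · intro h
    refine ⟨_, Presheaf.equalizerSieve_mem J φ ((Limits.cokernel.π L.ι).app _ n) 0 ?_, ?_⟩
    · exact (key _ n).symm.trans (h.trans (map_zero _).symm)
    · intro Y f hf
      rw [hres]
      exact hf.trans (map_zero (Q.presheaf.map f.op).hom)
  · rintro ⟨S, hS, h⟩
    -- The target is a sheaf, so vanishing may be checked on the covering sieve.
    refine ((sheafification (𝟙 R.obj)).obj Q).isSheaf.isSeparated _ S hS _ _ fun Y f hf => ?_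
    have h1 : Q.map f.op ((Limits.cokernel.π L.ι).app _ n) = 0 := (hres f).1 (h f hf)
    have h2 : g.val.app (op Y) (N.val.restrictₛₗ f.op n) = 0 := by
      have : (Limits.cokernel.π L.ι).app (op Y) (N.val.restrictₛₗ f.op n) = 0 :=
        (L.cokernel_π_eq_zero_iff _ _).2 (h f hf)
      refine (key _ _).trans ((congrArg (φ.app (op Y)) this).trans ?_)
      exact map_zero (φ.app (op Y)).hom
    refine ((naturality_apply g.val f.op n).symm.trans h2).trans ?_
    exact (map_zero (((sheafification (𝟙 R.obj)).obj Q).val.map f.op).hom).symm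

/-- The image of a morphism of presheaves of modules. -/
def rangeSubmodule {S : Cᵒᵖ ⥤ RingCat.{u}} {M N : PresheafOfModules.{v} S} (f : M ⟶ N) :
    N.Submodule where
  obj X := LinearMap.range (f.app X).hom
  map {X Y} i := by
    rintro _ ⟨m, rfl⟩
    exact ⟨M.map i m, naturality_apply f i m⟩

/-- The submodule generated by a family of sections. -/
def spanSubmodule {S : Cᵒᵖ ⥤ RingCat.{u}} {N : PresheafOfModules.{v} S} {I : Type*}
    (s : I → N.sections) : N.Submodule where
  obj X := _root_.Submodule.span (S.obj X) (Set.range fun i => (s i).eval X)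
  map {X Y} f := by
    rw [_root_.Submodule.span_le]
    rintro _ ⟨i, rfl⟩
    refine _root_.Submodule.subset_span ⟨i, ?_⟩
    exact ((sections_property (s i) f)).symm

end PresheafOfModules

/-! ### Local lifts, generators and coordinates -/

namespace SheafOfModules
universe v u v' u'
variable {C : Type u'} [Category.{v'} C] {J : GrothendieckTopology C} {R : Sheaf J RingCat.{u}}

/-- The test morphism whose kernel is the local image of `f` annihilates `f`, hence vanishes as `f`
is epi; so every section is locally in the image. -/
lemma exists_preimage_of_epi [J.WEqualsLocallyBijective AddCommGrpCat.{v}]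
    [HasWeakSheafify J AddCommGrpCat.{v}] {M N : SheafOfModules.{v} R} (f : M ⟶ N) [Epi f]
    (X : C) (n : N.val.obj (op X)) :
    ∃ S ∈ J X, ∀ ⦃Y : C⦄ (i : Y ⟶ X), S.arrows i →
      ∃ m : M.val.obj (op Y), f.val.app (op Y) m = N.val.restrictₛₗ i.op n := by
  obtain ⟨T, g, hg⟩ := (PresheafOfModules.rangeSubmodule f.val).exists_hom_eq_zero_iff (J := J)
  refine (hg X n).1 ?_
  have : g = 0 := by
    rw [← cancel_epi f, Limits.comp_zero]
    ext Y m
    exact (hg Y.unop _).2 ⟨⊤, J.top_mem _, fun Z i _ => ⟨M.val.map i.op m,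
      PresheafOfModules.naturality_apply f.val i.op m⟩⟩
  rw [this]
  rfl

/-- The test morphism for the image of `f` factors through the cokernel, so it kills whatever the
projection kills. -/
lemma exists_preimage_of_cokernel_π_eq_zero [J.WEqualsLocallyBijective AddCommGrpCat.{v}]
    [HasSheafify J AddCommGrpCat.{v}] {M N : SheafOfModules.{v} R} (f : M ⟶ N)
    (X : C) (n : N.val.obj (op X)) (hn : (Limits.cokernel.π f).val.app (op X) n = 0) :
    ∃ S ∈ J X, ∀ ⦃Y : C⦄ (i : Y ⟶ X), S.arrows i →
      ∃ m : M.val.obj (op Y), f.val.app (op Y) m = N.val.restrictₛₗ i.op n := by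
  obtain ⟨T, g, hg⟩ := (PresheafOfModules.rangeSubmodule f.val).exists_hom_eq_zero_iff (J := J)
  refine (hg X n).1 ?_
  have h : f ≫ g = 0 := by
    ext Y m
    exact (hg Y.unop _).2 ⟨⊤, J.top_mem _, fun Z i _ => ⟨M.val.map i.op m,
      PresheafOfModules.naturality_apply f.val i.op m⟩⟩
  rw [← Limits.cokernel.π_desc f g h]
  change (Limits.cokernel.desc f g h).val.app (op X) ((Limits.cokernel.π f).val.app (op X) n) = 0
  rw [hn, map_zero]

/-- Sections generating a sheaf of modules generate it locally. -/
lemma GeneratingSections.exists_mem_span [J.WEqualsLocallyBijective AddCommGrpCat.{u}]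
    [HasWeakSheafify J AddCommGrpCat.{u}] {N : SheafOfModules.{u} R} (σ : N.GeneratingSections)
    (X : C) (n : N.val.obj (op X)) :
    ∃ S ∈ J X, ∀ ⦃Y : C⦄ (i : Y ⟶ X), S.arrows i →
      N.val.restrictₛₗ i.op n ∈ Submodule.span (R.obj.obj (op Y))
        (Set.range fun j => (σ.s j).eval (op Y)) := by
  obtain ⟨T, g, hg⟩ := (PresheafOfModules.spanSubmodule σ.s).exists_hom_eq_zero_iff (J := J)
  refine (hg X n).1 ?_
  have : g = 0 := by
    rw [← cancel_epi σ.π, Limits.comp_zero, freeHomEquiv_symm_comp, Equiv.symm_apply_eq]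
    ext j Y
    refine ((hg Y.unop ((σ.s j).eval Y)).2 ⟨⊤, J.top_mem _, fun Z i _ => ?_⟩).trans ?_
    · exact Submodule.subset_span ⟨j, (PresheafOfModules.sections_property (σ.s j) i.op).symm⟩
    · rfl
  rw [this]
  rfl

/-- Sections defining an isomorphism from a free module have coordinate functions. -/
lemma GeneratingSections.exists_coord [J.WEqualsLocallyBijective AddCommGrpCat.{u}]
    [HasWeakSheafify J AddCommGrpCat.{u}] {N : SheafOfModules.{u} R} (σ : N.GeneratingSections)
    [IsIso σ.π] [DecidableEq σ.I] (i : σ.I) :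
    ∃ p : N ⟶ unit R, ∀ (j : σ.I) (X : C),
      p.val.app (op X) ((σ.s j).eval (op X)) = (if i = j then (1 : R.obj.obj (op X)) else 0) := by
  -- The Kronecker delta: `unitHomEquiv` sends the identity to the section 1. The coordinate
  -- function is the inverse of `σ.π` followed by the map of the free module with these values.
  let t : σ.I → (unit R).sections := fun j => if i = j then unitHomEquiv _ (𝟙 _) else unitHomEquiv _ 0
  refine ⟨inv σ.π ≫ (unit R).freeHomEquiv.symm t, fun j X => ?_⟩
  have h : σ.π ≫ inv σ.π ≫ (unit R).freeHomEquiv.symm t = (unit R).freeHomEquiv.symm t := by simp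
  have h' : sectionsMap (inv σ.π ≫ (unit R).freeHomEquiv.symm t) (σ.s j) = t j := by
    rw [freeHomEquiv_symm_comp, Equiv.apply_eq_iff_eq] at h
    exact congrFun h j
  have := congrArg (fun s : (unit R).sections => s.eval (op X)) h'
  refine this.trans ?_
  dsimp [t]
  split_ifs <;> rfl

/-- A finite biproduct of copies of the unit is free. -/
lemma exists_generatingSections_of_total [J.WEqualsLocallyBijective AddCommGrpCat.{u}]
    [HasWeakSheafify J AddCommGrpCat.{u}] {N : SheafOfModules.{u} R} {K : Type u} [Fintype K]
    [DecidableEq K] (ι : K → (unit R ⟶ N)) (p : K → (N ⟶ unit R))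
    (hι : ∀ k j, ι k ≫ p j = if k = j then 𝟙 _ else 0) (total : ∑ k, p k ≫ ι k = 𝟙 N) :
    ∃ σ : N.GeneratingSections, IsIso σ.π := by
  let s : K → N.sections := fun k => unitHomEquiv _ (ι k)
  have hs : ∀ k, ιFree k ≫ N.freeHomEquiv.symm s = ι k := fun k => by
    rw [← unitHomEquiv_symm_freeHomEquiv_apply]
    simp [s]
  -- The inverse collects the coordinates `p k` into the free module.
  have hiso : IsIso (N.freeHomEquiv.symm s) := by
    refine ⟨∑ k, p k ≫ ιFree k, ?_, ?_⟩
    · have hext : ∀ a b : free (R := R) K ⟶ free K, (∀ k, ιFree k ≫ a = ιFree k ≫ b) → a = b :=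
        fun _ _ => Limits.Cofan.IsColimit.hom_ext (isColimitFreeCofan K) _ _
      refine hext _ _ fun k => ?_
      rw [← Category.assoc, hs]
      simp [Preadditive.comp_sum, ← Category.assoc, hι, ite_comp]
    · rw [Preadditive.sum_comp, ← total]
      simp [hs]
  exact ⟨⟨K, s, inferInstance⟩, hiso⟩

/-! ### Locally split maps have locally free cokernels -/

section

variable [Limits.HasBinaryProducts C] [HasSheafify J AddCommGrpCat.{u}]
  [J.WEqualsLocallyBijective AddCommGrpCat.{u}]
  [∀ X, HasSheafify (J.over X) AddCommGrpCat.{u}]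
  [∀ X, (J.over X).WEqualsLocallyBijective AddCommGrpCat.{u}]

/-- Being a left adjoint, restriction to `X` preserves cokernels and epimorphisms; so the cokernel
can be computed locally. -/
instance (X : C) : (overFunctor.{u} R X).IsLeftAdjoint :=
  inferInstanceAs (pushforward.{u} (𝟙 (R.over X))).IsLeftAdjoint

lemma exists_over_cokernel_desc {M N : SheafOfModules.{u} R} (f : M ⟶ N) (X : C)
    {T : SheafOfModules.{u} (R.over X)} (g : N.over X ⟶ T) (hg : f.over X ≫ g = 0) :
    ∃ g' : (Limits.cokernel f).over X ⟶ T, (Limits.cokernel.π f : N ⟶ Limits.cokernel f).over X ≫ g' = g := by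
  have h := Limits.isColimitOfHasCokernelOfPreservesColimit (overFunctor.{u} R X) f
  obtain ⟨l, hl⟩ := Limits.CokernelCofork.IsColimit.desc' h g hg
  exact ⟨l, hl⟩

/-- If locally `f` has a retraction whose kernel is free of finite rank, then its cokernel is
locally free. -/
lemma isLocallyFree_cokernel {M N L : SheafOfModules.{u} R} (f : M ⟶ N) (e : unit R ≅ L)
    {I : Type*} (X : I → C) (hX : J.CoversTop X)
    (h : ∀ i, ∃ (K : Type u) (_ : Fintype K) (_ : DecidableEq K) (r : N.over (X i) ⟶ M.over (X i))
      (ι : K → (L.over (X i) ⟶ N.over (X i))) (p : K → (N.over (X i) ⟶ L.over (X i))),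
      (∀ k, f.over (X i) ≫ p k = 0) ∧ (∀ k j, ι k ≫ p j = if k = j then 𝟙 _ else 0) ∧
      r ≫ f.over (X i) + ∑ k, p k ≫ ι k = 𝟙 _) :
    (Limits.cokernel f).IsLocallyFree := by
  have h' : ∀ i, ∃ σ : ((Limits.cokernel f).over (X i)).GeneratingSections, IsIso σ.π := by
    intro i
    obtain ⟨K, _, _, r, ι₀, p₀, hp₀, hι₀, ht₀⟩ := h i
    let e' : unit (R.over (X i)) ≅ L.over (X i) := (overFunctor R (X i)).mapIso e
    let ι k := e'.hom ≫ ι₀ k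
    let p k := p₀ k ≫ e'.inv
    have hp k : f.over (X i) ≫ p k = 0 := by rw [← Category.assoc, hp₀, Limits.zero_comp]
    have hι k j : ι k ≫ p j = if k = j then 𝟙 _ else 0 := by
      rw [Category.assoc, ← Category.assoc (ι₀ k), hι₀]
      split_ifs <;> simp
    have ht : r ≫ f.over (X i) + ∑ k, p k ≫ ι k = 𝟙 _ := by simpa [p, ι] using ht₀
    have hepi : Epi ((Limits.cokernel.π f : N ⟶ Limits.cokernel f).over (X i)) :=
      inferInstanceAs (Epi ((overFunctor.{u} R (X i)).map (Limits.cokernel.π f)))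
    choose p' hp' using fun k => exists_over_cokernel_desc f (X i) (p k) (hp k)
    refine exists_generatingSections_of_total
      (fun k => ι k ≫ (Limits.cokernel.π f : N ⟶ Limits.cokernel f).over (X i)) p' (fun k j => ?_) ?_
    · rw [Category.assoc, hp', hι]
    · rw [← cancel_epi ((Limits.cokernel.π f : N ⟶ Limits.cokernel f).over (X i))]
      have h0 : f.over (X i) ≫ (Limits.cokernel.π f : N ⟶ Limits.cokernel f).over (X i) = 0 := by
        rw [← Functor.map_comp, Limits.cokernel.condition, Functor.map_zero]
      -- Projecting the splitting identity to the cokernel kills the summand that passes through `f`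
      -- and leaves the biproduct identity there.
      have := congrArg (fun φ => φ ≫ (Limits.cokernel.π f : N ⟶ Limits.cokernel f).over (X i)) ht
      simp only [Preadditive.add_comp, Category.assoc, h0, Limits.comp_zero, zero_add,
        Category.id_comp, Preadditive.sum_comp] at this
      rw [Category.comp_id, Preadditive.comp_sum]
      refine (Finset.sum_congr rfl fun k _ => ?_).trans this
      rw [← Category.assoc, hp']
  choose σ hσ using h'
  have : LocalGeneratorsData.IsLocallyFreeData ⟨I, X, hX, σ⟩ := ⟨hσ⟩
  exact LocalGeneratorsData.isLocallyFree ⟨I, X, hX, σ⟩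

end

/-- The forgetful functor to presheaves preserves monomorphisms, and these are injective objectwise.
-/
lemma val_app_injective_of_mono {M N : SheafOfModules.{v} R} (f : M ⟶ N) [Mono f] (X : Cᵒᵖ) :
    Function.Injective (f.val.app X) := by
  have : Mono f.val := inferInstanceAs (Mono ((forget R).map f))
  exact PresheafOfModules.injective_of_mono f.val X

lemma mono_of_injective {M N : SheafOfModules.{v} R} (f : M ⟶ N)
    (h : ∀ X, Function.Injective (f.val.app X)) : Mono f := by
  have : Mono f.val := PresheafOfModules.mono_of_injective fun X => h X
  exact (forget R).mono_of_mono_map this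

/-! ### Local bases of locally free sheaves on a topological space -/

section Opens

variable {X : TopCat.{u}} {R : Sheaf (Opens.grothendieckTopology X) RingCat.{u}}

/-- The section over `V ≤ U` given by a section of the restriction of a sheaf of modules to `U`. -/
def evalOver {M : SheafOfModules.{u} R} {U : Opens X} (s : (M.over U).sections) {V : Opens X}
    (h : V ⟶ U) : M.val.obj (op V) :=
  s.eval (op (Over.mk h))

lemma restrict_evalOver {M : SheafOfModules.{u} R} {U : Opens X} (s : (M.over U).sections)
    {V W : Opens X} (h : V ⟶ U) (f : W ⟶ V) :
    M.val.restrictₛₗ f.op (evalOver s h) = evalOver s (f ≫ h) :=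
  PresheafOfModules.sections_property s (Over.homMk f : Over.mk (f ≫ h) ⟶ Over.mk h).op

/-- Sections over `U` generating a sheaf of modules over `U` generate it locally. -/
lemma GeneratingSections.exists_mem_span_over {M : SheafOfModules.{u} R} {U : Opens X}
    (σ : (M.over U).GeneratingSections) (V : Opens X) (h : V ⟶ U) (m : M.val.obj (op V)) (y : X)
    (hy : y ∈ V) : ∃ (V' : Opens X) (_ : y ∈ V') (f : V' ⟶ V), M.val.restrictₛₗ f.op m ∈
      Submodule.span (R.obj.obj (op V'))
        (Set.range fun i => evalOver (σ.s i) (f ≫ h)) := by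
  obtain ⟨S, hS, hm⟩ := σ.exists_mem_span (Over.mk h) m
  rw [GrothendieckTopology.mem_over_iff] at hS
  obtain ⟨V', f, hf, hy'⟩ := hS y hy
  rw [Sieve.overEquiv_iff] at hf
  exact ⟨V', hy', f, hm _ hf⟩

lemma GeneratingSections.exists_coord_over {M : SheafOfModules.{u} R} {U : Opens X}
    (σ : (M.over U).GeneratingSections) [IsIso σ.π] (i : σ.I) (V : Opens X) (h : V ⟶ U) :
    ∃ p : M.val.obj (op V) →ₗ[R.obj.obj (op V)] R.obj.obj (op V),
      p (evalOver (σ.s i) h) = 1 ∧ ∀ j, j ≠ i → p (evalOver (σ.s j) h) = 0 := by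
  classical
  obtain ⟨p, hp⟩ := σ.exists_coord i
  exact ⟨{  toFun := fun m => p.val.app (op (Over.mk h)) m
            map_add' := fun a b => (p.val.app (op (Over.mk h))).hom.map_add a b
            map_smul' := fun a b => (p.val.app (op (Over.mk h))).hom.map_smul a b },
    (hp i (Over.mk h)).trans (if_pos rfl),
    fun k hk => (hp k (Over.mk h)).trans (if_neg hk.symm)⟩

/-- A locally free sheaf of modules on a topological space locally has a basis. -/
lemma IsLocallyFree.exists_basis (M : SheafOfModules.{u} R) [hM : M.IsLocallyFree] (x : X) :
    ∃ (U : Opens X) (_ : x ∈ U) (I : Type u) (e : I → (M.over U).sections),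
      (∀ (i : I) (V : Opens X) (h : V ⟶ U), ∃ p : M.val.obj (op V) →ₗ[R.obj.obj (op V)]
        R.obj.obj (op V), p (evalOver (e i) h) = 1 ∧ ∀ j, j ≠ i → p (evalOver (e j) h) = 0) ∧
      ∀ (V : Opens X) (h : V ⟶ U) (m : M.val.obj (op V)), ∀ y ∈ V,
        ∃ (V' : Opens X) (_ : y ∈ V') (f : V' ⟶ V), M.val.restrictₛₗ f.op m ∈
          Submodule.span (R.obj.obj (op V'))
            (Set.range fun i => evalOver (e i) (f ≫ h)) := by
  obtain ⟨q, hq⟩ := hM.exists_isLocallyFreeData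
  obtain ⟨W, f, ⟨i, ⟨g⟩⟩, hxW⟩ := q.coversTop ⊤ x trivial
  have hi := hq.isIso i
  exact ⟨q.X i, g.le hxW, (q.generators i).I, (q.generators i).s,
    (q.generators i).exists_coord_over, (q.generators i).exists_mem_span_over⟩

end Opens

end SheafOfModules

/-! ### Relations modulo a submodule with locally free quotient -/

namespace SheafOfModules
universe u
section Opens

variable {X : TopCat.{u}} {R : Sheaf (Opens.grothendieckTopology X) RingCat.{u}}

/-- Restriction of functions. -/
abbrev resRing (R : Sheaf (Opens.grothendieckTopology X) RingCat.{u}) {V V' : Opens X}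
    (h : V' ≤ V) : R.obj.obj (op V) →+* R.obj.obj (op V') :=
  (R.obj.map (homOfLE h).op).hom

/-- Restriction of sections. -/
abbrev res (M : SheafOfModules.{u} R) {V V' : Opens X} (h : V' ≤ V) :
    M.val.obj (op V) →ₛₗ[resRing R h] M.val.obj (op V') :=
  M.val.restrictₛₗ (homOfLE h).op

lemma res_res (M : SheafOfModules.{u} R) {V V' V'' : Opens X} (h : V' ≤ V) (h' : V'' ≤ V')
    (m : M.val.obj (op V)) : M.res h' (M.res h m) = M.res (h'.trans h) m :=
  (PresheafOfModules.map_comp_apply M.val (homOfLE h).op (homOfLE h').op m).symm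

lemma resRing_resRing {V V' V'' : Opens X} (h : V' ≤ V) (h' : V'' ≤ V')
    (m : R.obj.obj (op V)) : resRing R h' (resRing R h m) = resRing R (h'.trans h) m :=
  (ConcreteCategory.congr_hom (R.obj.map_comp (homOfLE h).op (homOfLE h').op) m).symm

lemma res_app {M N : SheafOfModules.{u} R} (f : M ⟶ N) {V V' : Opens X} (h : V' ≤ V)
    (m : M.val.obj (op V)) :
    N.res h ((f.val.app (op V)).hom m) = (f.val.app (op V')).hom (M.res h m) :=
  (PresheafOfModules.naturality_apply f.val (homOfLE h).op m).symm

lemma res_evalOver {M : SheafOfModules.{u} R} {U : Opens X} (s : (M.over U).sections)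
    {V W : Opens X} (h : V ≤ U) (h' : W ≤ V) :
    M.res h' (evalOver s (homOfLE h)) = evalOver s (homOfLE (h'.trans h)) :=
  restrict_evalOver s (homOfLE h) (homOfLE h')

lemma exists_open_forall {K : Type*} [Finite K] (x : X) (V₀ : Opens X) (hx : x ∈ V₀)
    (P : K → ∀ V : Opens X, V ≤ V₀ → Prop) (hP : ∀ k V V' (h : V ≤ V₀) (h' : V' ≤ V), P k V h →
      P k V' (h'.trans h)) (h : ∀ k, ∃ (V : Opens X) (h : V ≤ V₀), x ∈ V ∧ P k V h) :
    ∃ (V : Opens X) (h : V ≤ V₀), x ∈ V ∧ ∀ k, P k V h := by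
  choose V hV hxV hPV using h
  -- The factor `V₀` keeps the intersection inside `V₀` even when `K` is empty.
  refine ⟨V₀ ⊓ ⟨⋂ k, (V k : Set X), isOpen_iInter_of_finite fun k => (V k).2⟩, inf_le_left,
    ⟨hx, by simpa using hxV⟩, fun k => hP k (V k) _ (hV k) ?_ (hPV k)⟩
  exact inf_le_right.trans (fun y hy => Set.mem_iInter.1 hy k)

/-- If `f` is a monomorphism whose cokernel is locally free, then a linear combination
`∑ a k • d k` belonging to the image of `f` is locally the image of a linear combination with
the same coefficients. -/
lemma exists_eq_sum_smul {M N : SheafOfModules.{u} R} (f : M ⟶ N) [Mono f]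
    (hf : (Limits.cokernel f).IsLocallyFree) (x : X) (V₀ : Opens X) (hx : x ∈ V₀)
    {K : Type} [Fintype K] (a : K → R.obj.obj (op V₀)) (d : K → N.val.obj (op V₀))
    (m : M.val.obj (op V₀)) (h : (f.val.app (op V₀)).hom m = ∑ k, a k • d k) :
    ∃ (V : Opens X) (hV : V ≤ V₀) (_ : x ∈ V) (m' : K → M.val.obj (op V)),
      M.res hV m = ∑ k, resRing R hV (a k) • m' k := by
  classical
  let π := Limits.cokernel.π f
  have hπf : ∀ (V : Opens X) (m : M.val.obj (op V)),
      (π.val.app (op V)).hom ((f.val.app (op V)).hom m) = 0 := fun V m =>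
    congrArg (fun φ : M ⟶ Limits.cokernel f => (φ.val.app (op V)).hom m) (Limits.cokernel.condition f)
  obtain ⟨U, hxU, I, e, hcoord, hspan⟩ := IsLocallyFree.exists_basis (Limits.cokernel f) x
  -- the images of the `d k` in terms of the basis
  obtain ⟨V₁, hV₁, hx₁, h₁⟩ := exists_open_forall x (V₀ ⊓ U) ⟨hx, hxU⟩
    (fun k V hV => (π.val.app (op V)).hom (N.res (hV.trans inf_le_left) (d k)) ∈
      Submodule.span (R.obj.obj (op V))
        (Set.range fun i => evalOver (e i) (homOfLE (hV.trans inf_le_right))))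
    (by
      intro k V V' hV hV' hk
      have hle : Submodule.span (R.obj.obj (op V))
          (Set.range fun i => evalOver (e i) (homOfLE (hV.trans inf_le_right))) ≤
          (Submodule.span (R.obj.obj (op V')) (Set.range fun i => evalOver (e i)
            (homOfLE ((hV'.trans hV).trans inf_le_right)))).comap
              ((Limits.cokernel f).res hV') := by
        rw [Submodule.span_le]
        rintro _ ⟨i, rfl⟩
        refine Submodule.subset_span ⟨i, ?_⟩
        exact (res_evalOver (e i) _ _).symm
      have := hle hk
      rw [Submodule.mem_comap, res_app, res_res] at this
      exact this)
    (by
      intro k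
      obtain ⟨V', hy, i, hi⟩ := hspan (V₀ ⊓ U) (homOfLE inf_le_right)
        ((π.val.app (op (V₀ ⊓ U))).hom (N.res inf_le_left (d k))) x ⟨hx, hxU⟩
      refine ⟨V', i.le, hy, ?_⟩
      have := res_app π i.le (N.res inf_le_left (d k))
      rw [res_res] at this
      rw [← this]
      exact hi)
  have hVU : V₁ ≤ U := hV₁.trans inf_le_right
  have hV0 : V₁ ≤ V₀ := hV₁.trans inf_le_left
  simp only [Finsupp.mem_span_range_iff_exists_finsupp] at h₁
  choose b hb using h₁
  -- The image of `m` vanishes in the cokernel, so each coordinate of `∑ a k • π (d k)` is zero.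
  have hab : ∀ i, ∑ k, resRing R hV0 (a k) * b k i = 0 := by
    intro i
    obtain ⟨p, hp1, hp0⟩ := hcoord i V₁ (homOfLE hVU)
    have hpb : ∀ k, p ((π.val.app (op V₁)).hom (N.res hV0 (d k))) = b k i := by
      intro k
      rw [← hb k, map_finsuppSum, Finsupp.sum, Finset.sum_eq_single i]
      · rw [map_smul, hp1, smul_eq_mul, mul_one]
      · intro j _ hj
        rw [map_smul, hp0 j hj, smul_zero]
      · intro hi
        rw [Finsupp.notMem_support_iff.1 hi, zero_smul, map_zero]
    have h0 := hπf V₁ (M.res hV0 m)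
    rw [← res_app, h, map_sum, map_sum] at h0
    have h1 := congrArg p h0
    rw [map_sum, map_zero] at h1
    rw [← h1]
    refine Finset.sum_congr rfl fun k _ => ?_
    rw [map_smulₛₗ, map_smul, map_smul, hpb, smul_eq_mul]
  -- lifts of the basis elements that occur
  let J := Finset.univ.biUnion fun k => (b k).support
  obtain ⟨V₂, hV₂, hx₂, h₂⟩ := exists_open_forall (K := J) x V₁ hx₁
    (fun i V hV => ∃ y : N.val.obj (op V),
      (π.val.app (op V)).hom y = evalOver (e i) (homOfLE (hV.trans hVU)))
    (by
      rintro k V V' hV hV' ⟨y, hy⟩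
      exact ⟨N.res hV' y, by rw [← res_app, hy, res_evalOver]⟩)
    (by
      intro i
      obtain ⟨S, hS, h⟩ := exists_preimage_of_epi π V₁ (evalOver (e i) (homOfLE hVU))
      obtain ⟨V, g, hg, hxV⟩ := hS x hx₁
      obtain ⟨y, hy⟩ := h g hg
      exact ⟨V, g.le, hxV, y, hy.trans (res_evalOver (e i) hVU g.le)⟩)
  choose y hy using h₂
  -- Subtracting the lifted basis expansion from `d k` gives a section that dies in the cokernel,
  -- hence comes locally from `M`; its preimage is `m' k`.
  let z : K → N.val.obj (op V₂) := fun k => N.res (hV₂.trans hV0) (d k) -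
    ∑ i : J, resRing R hV₂ (b k i) • y i
  have hz : ∀ k, (π.val.app (op V₂)).hom (z k) = 0 := by
    intro k
    rw [map_sub, map_sum, sub_eq_zero, ← res_res _ hV0 hV₂, ← res_app, ← hb, Finsupp.sum,
      map_sum]
    simp only [map_smul, map_smulₛₗ, hy, res_evalOver]
    rw [Finset.sum_coe_sort J (fun i => resRing R hV₂ (b k i) •
      evalOver (e i) (homOfLE (hV₂.trans hVU)))]
    refine Finset.sum_subset (Finset.subset_biUnion_of_mem (fun k => (b k).support)
      (Finset.mem_univ k)) fun i _ hi => ?_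
    rw [Finsupp.notMem_support_iff.1 hi, map_zero, zero_smul]
  obtain ⟨V₃, hV₃, hx₃, h₃⟩ := exists_open_forall (K := K) x V₂ hx₂
    (fun k V hV => ∃ m' : M.val.obj (op V), (f.val.app (op V)).hom m' = N.res hV (z k))
    (by
      rintro k V V' hV hV' ⟨y, hy⟩
      exact ⟨M.res hV' y, by rw [← res_app, hy, res_res]⟩)
    (by
      intro k
      obtain ⟨S, hS, h⟩ := exists_preimage_of_cokernel_π_eq_zero f V₂ (z k) (hz k)
      obtain ⟨V, g, hg, hxV⟩ := hS x hx₂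
      obtain ⟨y, hy⟩ := h g hg
      exact ⟨V, g.le, hxV, y, hy⟩)
  choose m' hm' using h₃
  refine ⟨V₃, (hV₃.trans hV₂).trans hV0, hx₃, m', val_app_injective_of_mono f (op V₃) ?_⟩
  change (f.val.app (op V₃)).hom _ = (f.val.app (op V₃)).hom _
  rw [← res_app, h, map_sum, map_sum]
  simp only [map_smulₛₗ, hm', z, map_sub, map_sum, smul_sub, Finset.sum_sub_distrib, res_res]
  -- The correction terms add up to `∑ i, (∑ k, a k * b k i) • y i`, which vanishes by `hab`. As `f`
  -- is injective on sections, the identity descends to `M`.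
  have h0 : ∑ k, resRing R ((hV₃.trans hV₂).trans hV0) (a k) • ∑ i : J,
      resRing R hV₃ (resRing R hV₂ (b k i)) • N.res hV₃ (y i) = 0 := by
    simp only [Finset.smul_sum, smul_smul]
    rw [Finset.sum_comm]
    refine Finset.sum_eq_zero fun i _ => ?_
    rw [← Finset.sum_smul]
    have := congrArg (fun c => resRing R hV₃ (resRing R hV₂ c)) (hab i)
    simp only [map_sum, map_mul, map_zero, resRing_resRing] at this ⊢
    rw [this, zero_smul]
  simp only [RingHom.id_apply, h0, sub_zero]

end Opens
end SheafOfModules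

/-! ### From a locally free cokernel to spanning at points -/

namespace Cox

lemma IsRegular.inv {ι : Type} {Z : Set (ι → ℂ)} {Y : Set (Cover Z)} {s : Y → ℂ}
    (hs : IsRegular Y s) (h : ∀ x, s x ≠ 0) : IsRegular Y (fun x => (s x)⁻¹) := by
  intro x
  obtain ⟨O, hO, hx, p, q, hpq⟩ := hs x
  refine ⟨O, hO, hx, q, p, fun y hy => ⟨fun h0 => h y ?_, ?_⟩⟩
  · rw [(hpq y hy).2, h0, zero_div]
  · simp only [(hpq y hy).2, inv_div]

lemma character_ne_zero {A : Type} [AddCommGroup A] (a : A) (g : Grp A) : character a g ≠ 0 :=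
  Units.ne_zero _

section

variable {ι A : Type} [AddCommGroup A] {deg : ι → A} {Z : Set (ι → ℂ)}

/-- A `G`-invariant open subset is the inverse image of an open subset of the quotient. -/
lemma exists_preim_eq {O : Set (Cover Z)} (hO : IsOpen O)
    (h : ∀ (g : Grp A) (x y : Cover Z), y.pt = act deg g x.pt → x ∈ O → y ∈ O) :
    ∃ U : Opens (Space deg Z), preim deg Z U = O := by
  have h1 : proj deg Z ⁻¹' (proj deg Z '' O) = O := by
    ext y
    constructor
    · rintro ⟨x, hx, hxy⟩
      obtain ⟨g, hg⟩ : (orbitSetoid deg Z).r x y := Quotient.exact hxy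
      exact h g x y hg hx
    · exact fun hy => ⟨y, hy, rfl⟩
  refine ⟨⟨proj deg Z '' O, ?_⟩, h1⟩
  have : IsOpen (proj deg Z ⁻¹' (proj deg Z '' O)) := by rwa [h1]
  exact isOpen_coinduced.2 this

lemma isOpen_eval_ne_zero (p : MvPolynomial ι ℂ) :
    IsOpen {x : Cover Z | MvPolynomial.eval x.pt p ≠ 0} :=
  TopologicalSpace.isOpen_generateFrom_of_mem ⟨p, rfl⟩

/-- An equivariant function of weight `a` on the inverse image of `U`, which is regular and has no
zeros. -/
structure IsUnitOfWeight (U : Opens (Space deg Z)) (a : A) (u : preim deg Z U → ℂ) : Prop where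
  regular : IsRegular _ u
  ne_zero : ∀ x, u x ≠ 0
  equivariant : ∀ (g : Grp A) (x y : preim deg Z U), y.1.pt = act deg g x.1.pt →
    u y = character a g * u x

lemma IsUnitOfWeight.restrict {U U' : Opens (Space deg Z)} (h : U' ≤ U) {a : A}
    {u : preim deg Z U → ℂ} (hu : IsUnitOfWeight U a u) :
    IsUnitOfWeight U' a (fun x => u ⟨x.1, preim_mono deg Z h x.2⟩) where
  regular := hu.regular.restrict (preim_mono deg Z h)
  ne_zero _ := hu.ne_zero _
  equivariant g _ _ hxy := hu.equivariant g _ _ hxy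

variable (deg Z) in
/-- The sheaves `O(D_i)` are locally trivial. -/
def LocallyTrivial : Prop :=
  ∀ p : Cover Z, ∃ U : Opens (Space deg Z), proj deg Z p ∈ U ∧
    ∃ u : ι → preim deg Z U → ℂ, ∀ i, IsUnitOfWeight U (deg i) (u i)

lemma dual_apply_single [DecidableEq ι] (l : Module.Dual ℂ (ι → ℂ)) (i : ι) (c : ℂ) :
    l (Pi.single i c) = l (Pi.single i 1) * c := by
  rw [mul_comm, ← smul_eq_mul, ← map_smul, ← Pi.single_smul, smul_eq_mul, mul_one]

lemma isSection_single [DecidableEq ι] {U : Opens (Space deg Z)} {i : ι} {s : preim deg Z U → ℂ}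
    (hs : IsRegular _ s) (hs' : ∀ (g : Grp A) (x y : preim deg Z U), y.1.pt = act deg g x.1.pt →
      s y = character (deg i) g * s x) :
    IsSection deg Z (coordRep deg) U (fun x => Pi.single i (s x)) where
  regular l := by
    have h : (fun x => l (Pi.single i (s x))) = fun x => l (Pi.single i 1) * s x :=
      funext fun x => dual_apply_single l i (s x)
    rw [h]
    exact (IsRegular.const _).mul hs
  equivariant g x y h := by
    ext j
    rw [hs' g x y h]
    by_cases hj : j = i
    · subst hj
      simp [coordRep]
    · simp [coordRep, hj]

lemma isSection_const {V : Type} [AddCommGroup V] [Module ℂ V] (U : Opens (Space deg Z)) (v : V) :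
    IsSection deg Z (Representation.trivial ℂ (Grp A) V) U (fun _ => v) where
  regular _ := IsRegular.const _
  equivariant g x y h := by simp

lemma isRegular_evalW {Y : Set (Cover Z)} {a : A} (e : Homog deg a ⊗[ℂ] WSpace A)
    (φ : Module.Dual ℂ (WSpace A)) : IsRegular Y (fun x => φ (evalW deg x.1.pt e)) :=
  isRegular_pairing (s := fun _ => φ) (fun _ => IsRegular.const _) e

lemma sum_smul_apply {V : Type} [AddCommGroup V] [Module ℂ V] {r : Representation ℂ (Grp A) V}
    {U : Opens (Space deg Z)} {K : Type} [Fintype K] (a : K → functionRing deg Z U)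
    (d : K → sectionModule deg Z r U) (x : preim deg Z U) :
    (∑ k, a k • d k).1 x = ∑ k, (a k).1 x • (d k).1 x := by
  have h := map_sum (sectionModule deg Z r U).subtype (fun k => a k • d k) Finset.univ
  have h' := congrFun h x
  rw [Finset.sum_apply] at h'
  exact h'

open SheafOfModules in
/-- If `O ⊗ W^∨ → ⨁ i, O(D_i)` is a monomorphism with locally free cokernel, then the values of
the sections `E_i` at each point span `W`. -/
lemma span_evalW_eq_top [Finite ι] (htriv : LocallyTrivial deg Z)
    (E : ∀ i, Homog deg (deg i) ⊗[ℂ] WSpace A) [hmono : Mono (eulerMap deg Z E)]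
    (hfree : (eulerCokernel deg Z E).IsLocallyFree) (p : Cover Z) :
    Submodule.span ℂ (Set.range fun i => evalW deg p.pt (E i)) = ⊤ := by
  classical
  have := Fintype.ofFinite ι
  by_contra hne
  obtain ⟨φ, hφ0, hφ⟩ := Submodule.exists_le_ker_of_lt_top _ (lt_top_iff_ne_top.2 hne)
  have hφ' : ∀ i, φ (evalW deg p.pt (E i)) = 0 := fun i =>
    hφ (Submodule.subset_span ⟨i, rfl⟩)
  obtain ⟨U, hpU, u, hu⟩ := htriv p
  -- Numerator and denominator both have weight `deg i`, so the quotient is an invariant function;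
  -- it vanishes at `p` by the choice of `φ`.
  let a : ι → functionRing deg Z U := fun i => ⟨fun x => φ (evalW deg x.1.pt (E i)) * (u i x)⁻¹,
    (isRegular_evalW _ _).mul ((hu i).regular.inv (hu i).ne_zero), fun g x y h => by
      simp only [h, evalW_act, (hu i).equivariant g x y h, map_smul, smul_eq_mul, mul_inv]
      have := character_ne_zero (deg i) g
      field_simp⟩
  let d : ι → sectionModule deg Z (coordRep deg) U := fun i =>
    ⟨fun x => Pi.single i (u i x), isSection_single (hu i).regular (hu i).equivariant⟩
  let m : sectionModule deg Z (Representation.trivial ℂ (Grp A) (Module.Dual ℂ (WSpace A))) U :=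
    ⟨fun _ => φ, isSection_const U φ⟩
  obtain ⟨V, hV, hpV, m', hm'⟩ := exists_eq_sum_smul (eulerMap deg Z E) hfree (proj deg Z p) U hpU
    a d m (by
      refine Subtype.ext (funext fun x => ?_)
      refine Eq.trans ?_ (sum_smul_apply a d x).symm
      ext i
      have : (∑ k, (a k).1 x • (d k).1 x) i = ∑ k, (a k).1 x * (Pi.single k (u k x) : ι → ℂ) i := by
        rw [Finset.sum_apply]
        rfl
      rw [this, Finset.sum_eq_single i]
      · simp only [a, Pi.single_eq_same, mul_assoc, inv_mul_cancel₀ ((hu i).ne_zero x), mul_one]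
        rfl
      · intro k _ hk
        rw [Pi.single_eq_of_ne hk.symm, mul_zero]
      · simp)
  have h := congrArg Subtype.val hm'
  -- The relation between sections evaluated at `p`, where all coefficients are zero.
  have h' : φ = ∑ k, (a k).1 ⟨p, hpU⟩ • (m' k).1 ⟨p, hpV⟩ :=
    (congrFun h ⟨p, hpV⟩).trans (sum_smul_apply (fun k => restrictRing deg Z hV (a k)) m' ⟨p, hpV⟩)
  refine hφ0 (h'.trans (Finset.sum_eq_zero fun k _ => ?_))
  simp [a, hφ']

end

end Cox

/-! ### From spanning at points to a local splitting -/

namespace Cox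

section

variable {ι A : Type} [AddCommGroup A] {deg : ι → A} {Z : Set (ι → ℂ)}
variable {V₁ V₂ : Type} [AddCommGroup V₁] [Module ℂ V₁] [AddCommGroup V₂] [Module ℂ V₂]
  {r₁ : Representation ℂ (Grp A) V₁} {r₂ : Representation ℂ (Grp A) V₂}

/-- `T` maps sections to sections on all open subsets of `U`. -/
def PreservesSections (r₁ : Representation ℂ (Grp A) V₁) (r₂ : Representation ℂ (Grp A) V₂)
    (U : Opens (Space deg Z)) (T : preim deg Z U → V₁ →ₗ[ℂ] V₂) : Prop :=
  ∀ (V : Opens (Space deg Z)) (hV : V ≤ U) (s : preim deg Z V → V₁), IsSection deg Z r₁ V s →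
    IsSection deg Z r₂ V (fun x => T ⟨x.1, preim_mono deg Z hV x.2⟩ (s x))

/-- The morphism over `U` of the sheaves attached to two representations, given by a family of
linear maps. -/
def overHom {U : Opens (Space deg Z)} {T : preim deg Z U → V₁ →ₗ[ℂ] V₂}
    (hT : PreservesSections r₁ r₂ U T) : (sheafOf deg Z r₁).over U ⟶ (sheafOf deg Z r₂).over U where
  val := PresheafOfModules.homMk
    { app := fun Y => AddCommGrpCat.ofHom
        { toFun := fun s => ⟨fun x => T ⟨x.1, preim_mono deg Z Y.unop.hom.le x.2⟩ (s.1 x),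
            hT _ Y.unop.hom.le _ s.2⟩
          map_zero' := Subtype.ext (funext fun _ => map_zero _)
          map_add' := fun _ _ => Subtype.ext (funext fun _ => map_add _ _ _) }
      naturality := fun _ _ _ => rfl }
    (fun _ c s => Subtype.ext (funext fun x => map_smul (T _) (c.1 x) (s.1 x)))

lemma over_hom_ext {U : Opens (Space deg Z)}
    {f g : (sheafOf deg Z r₁).over U ⟶ (sheafOf deg Z r₂).over U}
    (h : ∀ (Y : (Over U)ᵒᵖ) (s : sectionModule deg Z r₁ Y.unop.left),
      (show sectionModule deg Z r₂ Y.unop.left from f.val.app Y s) =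
        (show sectionModule deg Z r₂ Y.unop.left from g.val.app Y s)) : f = g := by
  ext Y s
  exact h Y s

/-- The value at a point of the image of a section, as a function of the morphism. -/
def overEval {U : Opens (Space deg Z)} (Y : (Over U)ᵒᵖ) (s : sectionModule deg Z r₁ Y.unop.left)
    (x : preim deg Z Y.unop.left) :
    ((sheafOf deg Z r₁).over U ⟶ (sheafOf deg Z r₂).over U) →+ V₂ where
  toFun f := (show sectionModule deg Z r₂ Y.unop.left from f.val.app Y s).1 x
  map_zero' := rfl
  map_add' _ _ := rfl

lemma overEval_comp {V₃ : Type} [AddCommGroup V₃] [Module ℂ V₃] {r₃ : Representation ℂ (Grp A) V₃}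
    {U : Opens (Space deg Z)} (f : (sheafOf deg Z r₁).over U ⟶ (sheafOf deg Z r₂).over U)
    {T : preim deg Z U → V₂ →ₗ[ℂ] V₃} (hT : PreservesSections r₂ r₃ U T) (Y : (Over U)ᵒᵖ)
    (s : sectionModule deg Z r₁ Y.unop.left) (x : preim deg Z Y.unop.left) :
    overEval Y s x (f ≫ overHom hT) =
      T ⟨x.1, preim_mono deg Z Y.unop.hom.le x.2⟩ (overEval Y s x f) := rfl

lemma overEval_overHom {U : Opens (Space deg Z)}
    {T : preim deg Z U → V₁ →ₗ[ℂ] V₂} (hT : PreservesSections r₁ r₂ U T) (Y : (Over U)ᵒᵖ)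
    (s : sectionModule deg Z r₁ Y.unop.left) (x : preim deg Z Y.unop.left) :
    overEval Y s x (overHom hT) = T ⟨x.1, preim_mono deg Z Y.unop.hom.le x.2⟩ (s.1 x) := rfl

lemma overEval_id {U : Opens (Space deg Z)} (Y : (Over U)ᵒᵖ)
    (s : sectionModule deg Z r₁ Y.unop.left) (x : preim deg Z Y.unop.left) :
    overEval Y s x (𝟙 ((sheafOf deg Z r₁).over U)) = s.1 x := rfl

/-- Sections are functions on the cover, so identities between morphisms become linear algebra at
each point. -/
lemma over_hom_ext_eval {U : Opens (Space deg Z)}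
    {f g : (sheafOf deg Z r₁).over U ⟶ (sheafOf deg Z r₂).over U}
    (h : ∀ Y s x, overEval Y s x f = overEval Y s x g) : f = g :=
  over_hom_ext fun Y s => Subtype.ext (funext fun x => h Y s x)

variable (deg Z) in
/-- The sheaf attached to the trivial representation is the structure sheaf. -/
def unitIso : SheafOfModules.unit (structureSheaf deg Z) ≅
    sheafOf deg Z (Representation.trivial ℂ (Grp A) ℂ) where
  hom := ⟨PresheafOfModules.homMk
    { app := fun _ => AddCommGrpCat.ofHom
        { toFun := fun s => ⟨s.1, fun l => by
            have : (fun x => l (s.1 x)) = fun x => l 1 * s.1 x := by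
              ext x
              rw [mul_comm, ← smul_eq_mul, ← map_smul, smul_eq_mul, mul_one]
            rw [this]
            exact (IsRegular.const _).mul s.2.1, fun g x y h => by simpa using s.2.2 g x y h⟩
          map_zero' := rfl
          map_add' := fun _ _ => rfl }
      naturality := fun _ _ _ => rfl }
    (fun _ _ _ => rfl)⟩
  inv := ⟨PresheafOfModules.homMk
    { app := fun _ => AddCommGrpCat.ofHom
        { toFun := fun s => ⟨s.1, s.2.1 LinearMap.id, fun g x y h => s.2.2 g x y h⟩
          map_zero' := rfl
          map_add' := fun _ _ => rfl }
      naturality := fun _ _ _ => rfl }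
    (fun _ _ _ => rfl)⟩
  hom_inv_id := rfl
  inv_hom_id := rfl

/-- The linear map `φ ↦ (φ (E_i(x)))_i`. -/
def pairing (E : ∀ i, Homog deg (deg i) ⊗[ℂ] WSpace A) (x : ι → ℂ) :
    Module.Dual ℂ (WSpace A) →ₗ[ℂ] (ι → ℂ) :=
  LinearMap.pi fun i => LinearMap.applyₗ (evalW deg x (E i))

lemma IsSection.apply {U : Opens (Space deg Z)} {s : preim deg Z U → ι → ℂ}
    (hs : IsSection deg Z (coordRep deg) U s) (i : ι) : IsRegular _ (fun x => s x i) ∧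
      ∀ (g : Grp A) (x y : preim deg Z U), y.1.pt = act deg g x.1.pt →
        s y i = character (deg i) g * s x i :=
  ⟨hs.regular (LinearMap.proj i), fun g x y h => by simp [hs.equivariant g x y h, coordRep]⟩

lemma isSection_trivial {U : Opens (Space deg Z)} {s : preim deg Z U → ℂ} :
    IsSection deg Z (Representation.trivial ℂ (Grp A) ℂ) U s ↔ s ∈ functionRing deg Z U := by
  constructor
  · exact fun hs => ⟨hs.regular LinearMap.id, fun g x y h => hs.equivariant g x y h⟩
  · exact fun hs => (((unitIso deg Z).hom.val.app (op U)).hom ⟨s, hs⟩ :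
      sectionModule deg Z (Representation.trivial ℂ (Grp A) ℂ) U).2

/-- Multiplying by a function of weight `deg i` turns invariant functions into sections of $\mathcal
O(D_i)$. -/
lemma preservesSections_single [DecidableEq ι] {U : Opens (Space deg Z)} {i : ι}
    {u : preim deg Z U → ℂ} (hu : IsUnitOfWeight U (deg i) u) :
    PreservesSections (Representation.trivial ℂ (Grp A) ℂ) (coordRep deg) U
      (fun x => u x • LinearMap.single ℂ (fun _ => ℂ) i) := by
  intro V hV s hs
  obtain ⟨hs1, hs2⟩ := isSection_trivial.1 hs
  have : (fun x : preim deg Z V => (u ⟨x.1, preim_mono deg Z hV x.2⟩ •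
      LinearMap.single ℂ (fun _ => ℂ) i) (s x)) =
      fun x => Pi.single i (u ⟨x.1, preim_mono deg Z hV x.2⟩ * s x) := by
    ext x : 1
    simp [← Pi.single_smul]
  rw [this]
  have hu' := hu.restrict hV
  refine isSection_single (hu'.regular.mul hs1) fun g x y h => ?_
  rw [hs2 g x y h, hu'.equivariant g x y h, mul_assoc]

/-- The splitting identity at one point: `P` already gives the coordinates in `B`, and each other
coordinate is completed by its own summand, the factors `u k` cancelling. -/
lemma add_sum_single_eq [DecidableEq ι] (B : Set ι) [Fintype (Bᶜ : Set ι)]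
    (P : (ι → ℂ) →ₗ[ℂ] (ι → ℂ)) (u : ι → ℂ) (hu : ∀ i, u i ≠ 0) (s : ι → ℂ)
    (h : ∀ i ∈ B, P s i = s i) :
    P s + ∑ k : (Bᶜ : Set ι), (u k • LinearMap.single ℂ (fun _ => ℂ) k.1)
      (((u k)⁻¹ • LinearMap.proj k.1 ∘ₗ (LinearMap.id - P)) s) = s := by
  ext i
  rw [Pi.add_apply, Finset.sum_apply]
  by_cases hi : i ∈ B
  · rw [h i hi, Finset.sum_eq_zero, add_zero]
    intro k _
    have hki : i ≠ k.1 := fun hki => k.2 (hki ▸ hi)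
    simp [hki]
  · rw [Finset.sum_eq_single ⟨i, hi⟩]
    · simp [hu]
    · intro k _ hk
      have hki : i ≠ k.1 := fun hki => hk (Subtype.ext hki.symm)
      simp [hki]
    · simp

variable [Finite ι]

lemma preservesSections_pairing (E : ∀ i, Homog deg (deg i) ⊗[ℂ] WSpace A)
    (U : Opens (Space deg Z)) :
    PreservesSections (Representation.trivial ℂ (Grp A) (Module.Dual ℂ (WSpace A))) (coordRep deg) U
      (fun x => pairing E x.1.pt) :=
  fun _ _ _ hs => isSection_pairing hs E

/-- Near a point where the values of the `E_i` span `W`, a basis of `W` is given by the values of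
some of the `E_i`, and a functional is determined by its values at this basis. -/
lemma exists_retraction [Module.Finite ℂ (WSpace A)] (E : ∀ i, Homog deg (deg i) ⊗[ℂ] WSpace A)
    (p : Cover Z) (hp : Submodule.span ℂ (Set.range fun i => evalW deg p.pt (E i)) = ⊤) :
    ∃ (U : Opens (Space deg Z)) (_ : proj deg Z p ∈ U) (B : Set ι)
      (T : preim deg Z U → (ι → ℂ) →ₗ[ℂ] Module.Dual ℂ (WSpace A)),
      PreservesSections (coordRep deg) (Representation.trivial ℂ (Grp A) _) U T ∧
      ∀ (x : preim deg Z U) (s : ι → ℂ) (φ : Module.Dual ℂ (WSpace A)),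
        T x s = φ ↔ ∀ i ∈ B, pairing E x.1.pt φ i = s i := by
  classical
  -- A maximal linearly independent subfamily of the values at `p`, indexed through `a`; it is a
  -- basis `b` of `W`.
  obtain ⟨κ, a, ha, hspan, hli⟩ := exists_linearIndependent' ℂ fun i => evalW deg p.pt (E i)
  rw [hp] at hspan
  have : Finite κ := Finite.of_injective a ha
  have := Fintype.ofFinite κ
  let b := Module.Basis.mk hli hspan.ge
  have hpoly : ∀ c j, ∃ P : MvPolynomial ι ℂ, ∀ x : ι → ℂ,
      b.coord j (evalW deg x (E (a c))) = MvPolynomial.eval x P := by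
    intro c j
    generalize E (a c) = e
    induction e with
    | zero => exact ⟨0, by simp⟩
    | add e f he hf =>
      obtain ⟨P, hP⟩ := he
      obtain ⟨Q, hQ⟩ := hf
      exact ⟨P + Q, fun x => by simp only [map_add, hP, hQ]⟩
    | tmul q w =>
      refine ⟨q.1 * MvPolynomial.C (b.coord j w), fun x => ?_⟩
      simp [evalW]
  choose P hP using hpoly
  let M : Matrix κ κ (MvPolynomial ι ℂ) := Matrix.of P
  let Mx (x : ι → ℂ) : Matrix κ κ ℂ := (MvPolynomial.eval x).mapMatrix M
  -- `Mx x` expresses the chosen values at `x` in the fixed basis `b`, so it carries the values of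
  -- `φ` on `b` to its values on the chosen `E_i(x)`.
  have hMx : ∀ (x : ι → ℂ) (φ : Module.Dual ℂ (WSpace A)) (c : κ), (Mx x).mulVec (fun j => φ (b j)) c = φ (evalW deg x (E (a c))) := by
    intro x φ c
    conv_rhs => rw [← b.sum_repr (evalW deg x (E (a c))), map_sum]
    refine Finset.sum_congr rfl fun j _ => ?_
    rw [map_smul, smul_eq_mul]
    congr 1
    exact (hP c j x).symm
  have hdet : ∀ x, MvPolynomial.eval x M.det = (Mx x).det := fun x => RingHom.map_det _ _
  -- The group only rescales rows, so the locus where the determinant is nonzero is invariant and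
  -- descends to the quotient.
  have hact : ∀ (g : Grp A) x, Mx (act deg g x) = Matrix.diagonal (fun c => character (deg (a c)) g) * Mx x := by
    intro g x
    ext c j
    rw [Matrix.diagonal_mul]
    simp only [Mx, M, RingHom.mapMatrix_apply, Matrix.map_apply, Matrix.of_apply, ← hP, evalW_act,
      map_smul, smul_eq_mul]
  obtain ⟨U, hU⟩ := exists_preim_eq (deg := deg) (isOpen_eval_ne_zero (Z := Z) M.det)
    (by
      intro g x y h hx
      simp only [Set.mem_ofPred_eq, hdet, h, hact, Matrix.det_mul, Matrix.det_diagonal] at hx ⊢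
      exact mul_ne_zero (Finset.prod_ne_zero_iff.2 fun c _ => character_ne_zero _ _) hx)
  have hUdet : ∀ x ∈ preim deg Z U, (Mx x.pt).det ≠ 0 := by
    intro x hx
    rw [hU] at hx
    rw [← hdet]
    exact hx
  have hpU : p ∈ preim deg Z U := by
    rw [hU]
    -- At `p` the chosen values are the basis `b` itself.
    have : Mx p.pt = 1 := by
      ext c j
      have : evalW deg p.pt (E (a c)) = b c := by simp [b]
      simp only [Mx, M, RingHom.mapMatrix_apply, Matrix.map_apply, Matrix.of_apply, ← hP, this]
      simp [Matrix.one_apply, Finsupp.single_apply]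
    simp [hdet, this]
  -- Keep the chosen coordinates and solve for the unique functional with these values on the
  -- corresponding `E_i(x)`.
  let T (x : preim deg Z U) : (ι → ℂ) →ₗ[ℂ] Module.Dual ℂ (WSpace A) :=
    (b.constr ℂ).toLinearMap ∘ₗ (Mx x.1.pt)⁻¹.mulVecLin ∘ₗ LinearMap.funLeft ℂ ℂ a
  have hT : ∀ (x : preim deg Z U) (s : ι → ℂ) (φ : Module.Dual ℂ (WSpace A)),
        T x s = φ ↔ ∀ i ∈ Set.range a, pairing E x.1.pt φ i = s i := by
    intro x s φ
    have hunit : IsUnit (Mx x.1.pt).det := (hUdet _ x.2).isUnit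
    have h1 : T x s = φ ↔ (Mx x.1.pt)⁻¹.mulVec (s ∘ a) = fun j => φ (b j) := by
      constructor
      · rintro rfl
        ext j
        exact (b.constr_basis ℂ _ j).symm
      · intro h
        refine b.ext fun j => (b.constr_basis ℂ _ j).trans (congrFun h j)
    rw [h1]
    have h2 : (Mx x.1.pt)⁻¹.mulVec (s ∘ a) = (fun j => φ (b j)) ↔
        (Mx x.1.pt).mulVec (fun j => φ (b j)) = s ∘ a := by
      constructor
      · intro h
        rw [← h, Matrix.mulVec_mulVec, Matrix.mul_nonsing_inv _ hunit, Matrix.one_mulVec]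
      · intro h
        rw [← h, Matrix.mulVec_mulVec, Matrix.nonsing_inv_mul _ hunit, Matrix.one_mulVec]
    rw [h2, funext_iff, Set.forall_mem_range]
    exact forall_congr' fun c => by rw [hMx]; rfl
  refine ⟨U, hpU, Set.range a, T, fun V hV s hs => ⟨fun l => ?_, fun g x y h => ?_⟩, hT⟩
  -- By Cramer's rule, the inverse matrix has regular entries where the determinant is nonzero.
  · have hl : ∀ x : preim deg Z V, l (T ⟨x.1, preim_mono deg Z hV x.2⟩ (s x)) =
        ∑ j, (∑ c, ((MvPolynomial.eval x.1.pt M.det)⁻¹ *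
          MvPolynomial.eval x.1.pt (M.adjugate j c)) * s x (a c)) * l (b.coord j) := by
      intro x
      have : T ⟨x.1, preim_mono deg Z hV x.2⟩ (s x) =
          ∑ j, (Mx x.1.pt)⁻¹.mulVec (s x ∘ a) j • b.coord j := by
        refine b.ext fun i => ?_
        refine (b.constr_basis ℂ _ i).trans ?_
        simp [Finsupp.single_apply]
        rfl
      rw [this, map_sum]
      refine Finset.sum_congr rfl fun j _ => ?_
      rw [map_smul, smul_eq_mul]
      congr 1
      refine Finset.sum_congr rfl fun c _ => ?_
      congr 1
      have hinv : (Mx x.1.pt)⁻¹ j c = (Mx x.1.pt).det⁻¹ * (Mx x.1.pt).adjugate j c := by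
        rw [Matrix.inv_def, Ring.inverse_eq_inv', Matrix.smul_apply, smul_eq_mul]
      refine hinv.trans ?_
      rw [hdet]
      congr 1
      have := (MvPolynomial.eval x.1.pt).map_adjugate M
      exact (congrFun (congrFun this j) c).symm
    simp only [hl]
    refine IsRegular.sum _ _ fun j => IsRegular.mul (IsRegular.sum _ _ fun c => ?_) (IsRegular.const _)
    refine ((IsRegular.inv (IsRegular.of_eval _) fun x => ?_).mul (IsRegular.of_eval _)).mul
      (hs.apply _).1
    rw [hdet]
    exact hUdet _ (preim_mono deg Z hV x.2)
  -- By uniqueness in `hT`, it suffices that the old functional has the prescribed values at the new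
  -- point: both sides scale by the same character.
  · refine (hT _ _ _).2 fun i hi => ?_
    have h1 := (hT ⟨x.1, preim_mono deg Z hV x.2⟩ (s x) _).1 rfl i hi
    rw [(hs.apply i).2 g x y h, ← h1]
    simp [pairing, h, evalW_act]

/-- A functional is determined by its values on a spanning set, so the map is injective on sections
over every open set. -/
lemma mono_eulerMap (E : ∀ i, Homog deg (deg i) ⊗[ℂ] WSpace A)
    (h : ∀ p : Cover Z, Submodule.span ℂ (Set.range fun i => evalW deg p.pt (E i)) = ⊤) :
    Mono (eulerMap deg Z E) := by
  refine SheafOfModules.mono_of_injective _ fun U s t hst => ?_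
  refine Subtype.ext (funext fun x => LinearMap.ext_on_range (h x.1) fun i => ?_)
  exact congrFun (congrFun (congrArg Subtype.val hst) x) i

/-- A coordinate of the complementary projection has weight `deg i`; dividing by a unit of the same
weight makes it an invariant function. -/
lemma PreservesSections.sub_pairing {U : Opens (Space deg Z)}
    (E : ∀ i, Homog deg (deg i) ⊗[ℂ] WSpace A)
    {T : preim deg Z U → (ι → ℂ) →ₗ[ℂ] Module.Dual ℂ (WSpace A)}
    (hT : PreservesSections (coordRep deg) (Representation.trivial ℂ (Grp A) _) U T) {i : ι}
    {u : preim deg Z U → ℂ} (hu : IsUnitOfWeight U (deg i) u) :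
    PreservesSections (coordRep deg) (Representation.trivial ℂ (Grp A) ℂ) U
      (fun x => (u x)⁻¹ • LinearMap.proj i ∘ₗ (LinearMap.id - pairing E x.1.pt ∘ₗ T x)) := by
  intro V hV s hs
  have hu' := hu.restrict hV
  obtain ⟨h1, h2⟩ := hs.apply i
  obtain ⟨h3, h4⟩ := (preservesSections_pairing E U V hV _ (hT V hV s hs)).apply i
  refine isSection_trivial.2 ⟨?_, fun g x y h => ?_⟩
  · have hfun : (fun x : preim deg Z V => ((u ⟨x.1, preim_mono deg Z hV x.2⟩)⁻¹ •
        LinearMap.proj i ∘ₗ (LinearMap.id - pairing E x.1.pt ∘ₗ T ⟨x.1, preim_mono deg Z hV x.2⟩))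
          (s x)) = fun x : preim deg Z V => (u ⟨x.1, preim_mono deg Z hV x.2⟩)⁻¹ *
        (s x i + - pairing E x.1.pt (T ⟨x.1, preim_mono deg Z hV x.2⟩ (s x)) i) :=
      funext fun x => by simp [sub_eq_add_neg]
    rw [hfun]
    exact (hu'.regular.inv hu'.ne_zero).mul (h1.add h3.neg)
  · have h5 := h2 g x y h
    have h6 := h4 g x y h
    have h7 := hu'.equivariant g x y h
    have h8 := character_ne_zero (deg i) g
    have h9 := hu'.ne_zero x
    simp only [LinearMap.smul_apply, LinearMap.comp_apply, LinearMap.sub_apply, LinearMap.id_apply,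
      LinearMap.proj_apply, Pi.sub_apply, smul_eq_mul, h5, h6, h7]
    field_simp

/-- If the values of the `E_i` at each point span `W`, then `O ⊗ W^∨ → ⨁ i, O(D_i)` locally has a
retraction whose kernel is free of finite rank. -/
lemma exists_splitting [Module.Finite ℂ (WSpace A)] (htriv : LocallyTrivial deg Z)
    (E : ∀ i, Homog deg (deg i) ⊗[ℂ] WSpace A)
    (p : Cover Z) (h : Submodule.span ℂ (Set.range fun i => evalW deg p.pt (E i)) = ⊤) :
    ∃ (U : Opens (Space deg Z)) (_ : proj deg Z p ∈ U) (K : Type) (_ : Fintype K)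
      (_ : DecidableEq K)
      (r : (sheafOf deg Z (coordRep deg)).over U ⟶
        (sheafOf deg Z (Representation.trivial ℂ (Grp A) (Module.Dual ℂ (WSpace A)))).over U)
      (j : K → ((sheafOf deg Z (Representation.trivial ℂ (Grp A) ℂ)).over U ⟶
        (sheafOf deg Z (coordRep deg)).over U))
      (q : K → ((sheafOf deg Z (coordRep deg)).over U ⟶
        (sheafOf deg Z (Representation.trivial ℂ (Grp A) ℂ)).over U)),
      (∀ k, overHom (preservesSections_pairing E U) ≫ q k = 0) ∧
      (∀ k k', j k ≫ q k' = if k = k' then 𝟙 _ else 0) ∧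
      r ≫ overHom (preservesSections_pairing E U) + ∑ k, q k ≫ j k = 𝟙 _ := by
  classical
  have := Fintype.ofFinite ι
  obtain ⟨U₁, hU₁, B, T₁, hT₁, hTE₁⟩ := exists_retraction E p h
  obtain ⟨U₂, hU₂, u₂, hu₂⟩ := htriv p
  let U := U₁ ⊓ U₂
  let T (x : preim deg Z U) := T₁ ⟨x.1, preim_mono deg Z inf_le_left x.2⟩
  let u (i : ι) (x : preim deg Z U) := u₂ i ⟨x.1, preim_mono deg Z inf_le_right x.2⟩
  have hT : PreservesSections (coordRep deg) (Representation.trivial ℂ (Grp A) _) U T :=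
    fun V hV s hs => hT₁ V (hV.trans inf_le_left) s hs
  have hTE : ∀ x s φ, T x s = φ ↔ ∀ i ∈ B, pairing E x.1.pt φ i = s i := fun x => hTE₁ _
  have hTE' : ∀ x φ, T x (pairing E x.1.pt φ) = φ := fun x φ => (hTE x _ φ).2 fun _ _ => rfl
  have hu : ∀ i, IsUnitOfWeight U (deg i) (u i) := fun i => (hu₂ i).restrict inf_le_right
  have hsum : ∀ (x : preim deg Z U) (s : ι → ℂ), pairing E x.1.pt (T x s) +
      ∑ k : (Bᶜ : Set ι), (u k x • LinearMap.single ℂ (fun _ => ℂ) k.1)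
        (((u k x)⁻¹ • LinearMap.proj k.1 ∘ₗ (LinearMap.id - pairing E x.1.pt ∘ₗ T x)) s) = s :=
    fun x s => add_sum_single_eq B (pairing E x.1.pt ∘ₗ T x) (fun i => u i x)
      (fun i => (hu i).ne_zero x) s ((hTE x s (T x s)).1 rfl)
  refine ⟨U, ⟨hU₁, hU₂⟩, (Bᶜ : Set ι), Subtype.fintype _, inferInstance, overHom hT,
      fun k => overHom (preservesSections_single (hu k)),
      fun k => overHom (hT.sub_pairing E (hu k)), fun k => ?_, fun k j => ?_, ?_⟩
  · refine over_hom_ext_eval fun Y s x => ?_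
    rw [overEval_comp, overEval_overHom, map_zero]
    simp [hTE']
  · refine over_hom_ext_eval fun Y s x => ?_
    rw [overEval_comp, overEval_overHom]
    -- `T` sees only the coordinates in `B`, so it kills the coordinate vectors outside `B`; these
    -- are the free generators of its kernel.
    have h0 : ∀ c : ℂ, T ⟨x.1, preim_mono deg Z Y.unop.hom.le x.2⟩ (Pi.single k.1 c) = 0 := by
      intro c
      refine (hTE _ _ _).2 fun i hi => ?_
      have hki : i ≠ k.1 := fun hki => k.2 (hki ▸ hi)
      simp [hki]
    have hne := (hu j).ne_zero ⟨x.1, preim_mono deg Z Y.unop.hom.le x.2⟩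
    split_ifs with hkj
    · subst hkj
      rw [overEval_id]
      simp [h0, hne]
    · have hjk : j.1 ≠ k.1 := fun hjk => hkj (Subtype.ext hjk.symm)
      simp [h0, hjk]
  · refine over_hom_ext_eval fun Y s x => ?_
    rw [map_add, map_sum, overEval_id]
    simp only [overEval_comp, overEval_overHom]
    exact hsum ⟨x.1, preim_mono deg Z Y.unop.hom.le x.2⟩ (s.1 x)

/-- If the values of the `E_i` at each point span `W`, then the cokernel of
`O ⊗ W^∨ → ⨁ i, O(D_i)` is locally free. -/
lemma isLocallyFree_eulerCokernel [Module.Finite ℂ (WSpace A)] (htriv : LocallyTrivial deg Z)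
    (E : ∀ i, Homog deg (deg i) ⊗[ℂ] WSpace A)
    (h : ∀ p : Cover Z, Submodule.span ℂ (Set.range fun i => evalW deg p.pt (E i)) = ⊤) :
    (eulerCokernel deg Z E).IsLocallyFree := by
  choose U hpU hU using fun p => exists_splitting htriv E p (h p)
  -- The restriction of the Euler map to each open set is definitionally the `overHom` of the
  -- pointwise pairing, so `hU` applies as it stands.
  refine SheafOfModules.isLocallyFree_cokernel (eulerMap deg Z E) (unitIso deg Z) U ?_ hU
  intro V q hq
  obtain ⟨p, rfl⟩ := Quotient.exists_rep q
  exact ⟨V ⊓ U p, homOfLE inf_le_left, ⟨p, ⟨homOfLE inf_le_right⟩⟩, ⟨hq, hpU p⟩⟩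

end

end Cox

/-! ### Units of a given weight: products, powers and inverses -/

namespace Cox.IsUnitOfWeight

variable {ι A : Type} [AddCommGroup A] {deg : ι → A} {Z : Set (ι → ℂ)} {U : Opens (Space deg Z)}
  {a b : A} {u v : preim deg Z U → ℂ}

lemma one : IsUnitOfWeight U (0 : A) (fun _ => 1) where
  regular := IsRegular.const 1
  ne_zero _ := one_ne_zero
  equivariant g x y h := by simp [character]

lemma mul (hu : IsUnitOfWeight U a u) (hv : IsUnitOfWeight U b v) :
    IsUnitOfWeight U (a + b) (fun x => u x * v x) where
  regular := hu.regular.mul hv.regular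
  ne_zero x := mul_ne_zero (hu.ne_zero x) (hv.ne_zero x)
  equivariant g x y h := by
    have : character (a + b) g = character a g * character b g := by simp [character]
    rw [hu.equivariant g x y h, hv.equivariant g x y h, this]
    ring

lemma inv (hu : IsUnitOfWeight U a u) : IsUnitOfWeight U (-a) (fun x => (u x)⁻¹) where
  regular := hu.regular.inv hu.ne_zero
  ne_zero x := inv_ne_zero (hu.ne_zero x)
  equivariant g x y h := by
    have : character (-a) g = (character a g)⁻¹ := by simp [character]
    rw [hu.equivariant g x y h, this, mul_inv]

lemma pow (hu : IsUnitOfWeight U a u) (n : ℕ) : IsUnitOfWeight U (n • a) (fun x => u x ^ n) := by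
  induction n with
  | zero => simpa using one
  | succ n ih => simpa [pow_succ, succ_nsmul] using ih.mul hu

lemma zpow (hu : IsUnitOfWeight U a u) (n : ℤ) : IsUnitOfWeight U (n • a) (fun x => u x ^ n) := by
  cases n with
  | ofNat n => simpa using hu.pow n
  | negSucc n => simpa [negSucc_zsmul] using (hu.pow (n + 1)).inv

lemma prod {J : Type} (s : Finset J) {c : J → A} {w : J → preim deg Z U → ℂ}
    (h : ∀ j ∈ s, IsUnitOfWeight U (c j) (w j)) :
    IsUnitOfWeight U (∑ j ∈ s, c j) (fun x => ∏ j ∈ s, w j x) := by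
  classical
  induction s using Finset.induction_on with
  | empty => simpa using one
  | insert j s hj ih =>
    simp only [Finset.sum_insert hj, Finset.prod_insert hj]
    exact (h j (by simp)).mul (ih fun i hi => h i (by simp [hi]))

lemma of_homog {q : MvPolynomial ι ℂ} (hq : q ∈ Homog deg a)
    (h : ∀ x ∈ preim deg Z U, MvPolynomial.eval x.pt q ≠ 0) :
    IsUnitOfWeight U a (fun x => MvPolynomial.eval x.1.pt q) where
  regular := IsRegular.of_eval q
  ne_zero x := h x.1 x.2
  equivariant g x y hxy := by
    have := eval_act hq g x.1.pt
    rw [← hxy] at this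
    exact this

end Cox.IsUnitOfWeight

/-! ### Local triviality from smoothness of the fan -/

namespace SmoothProjectiveFan

open Cox

variable {n : ℕ} {R : Type} [Fintype R] [DecidableEq R] (F : SmoothProjectiveFan n R)

lemma gen_mem_coneHull {n : ℕ} (gen : R → Fin n → ℤ) (ρ : R) :
    (fun j => (gen ρ j : ℝ)) ∈ coneHull gen {ρ} := by
  refine ⟨Pi.single ρ 1, fun ρ' => ?_, fun ρ' h => ?_, fun j => ?_⟩
  · by_cases h : ρ' = ρ
    · subst h; simp
    · simp [h]
  · simp only [Finset.mem_singleton] at h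
    simp [h]
  · simp [Pi.single_apply]

/-- Two distinct rays meet only in the zero cone, so a common generator would be zero, contradicting
that it belongs to a lattice basis. -/
lemma gen_injective : Function.Injective F.gen := by
  intro ρ ρ' h
  by_contra hne
  have h1 := gen_mem_coneHull F.gen ρ
  have h2 := gen_mem_coneHull F.gen ρ'
  rw [← h] at h2
  have h3 := Set.mem_inter h1 h2
  rw [F.inter _ (F.singleton_mem ρ) _ (F.singleton_mem ρ'),
    Finset.singleton_inter_of_notMem (by simpa using hne)] at h3
  obtain ⟨c, -, hc, hy⟩ := h3
  obtain ⟨b, hb⟩ := F.smooth _ (F.singleton_mem ρ)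
  obtain ⟨j, hj⟩ := hb ρ (by simp)
  refine b.ne_zero j ?_
  rw [hj]
  ext i
  have := hy i
  simp only [hc _ (Finset.notMem_empty _), zero_mul, Finset.sum_const_zero] at this
  exact_mod_cast this

/-- The classes of the divisors not belonging to a cone generate the Picard group. -/
lemma exists_divClass_eq {σ : Finset R} (hσ : σ ∈ F.cones) (ρ : R) :
    ∃ c : R → ℤ, F.divClass ρ = ∑ ρ' ∈ σᶜ, c ρ' • F.divClass ρ' := by
  by_cases hρ : ρ ∈ σ
  · obtain ⟨b, hb⟩ := F.smooth σ hσ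
    obtain ⟨j, hj⟩ := hb ρ hρ
    -- The character dual to `gen ρ` in the basis `b`. Its divisor is zero in the Picard group and
    -- contains, among the rays of `σ`, only `ρ`, with multiplicity one; solving for `[D_ρ]` gives
    -- the claim.
    let m : Fin n → ℤ := fun i => b.coord j (Pi.single i 1)
    have hm : ∀ v : Fin n → ℤ, v ⬝ᵥ m = b.coord j v := by
      intro v
      conv_rhs => rw [pi_eq_sum_univ' v, map_sum]
      refine Finset.sum_congr rfl fun i _ => ?_
      rw [map_smul, smul_eq_mul]
    have hc : ∀ ρ', F.charDivisor m ρ' = b.coord j (F.gen ρ') := fun ρ' => hm _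
    have h0 : ∑ ρ', F.charDivisor m ρ' • F.divClass ρ' = 0 := by
      have h1 : (Submodule.Quotient.mk (F.charDivisor m) : F.Pic) = 0 :=
        (Submodule.Quotient.mk_eq_zero _).2 ⟨m, rfl⟩
      rw [← h1]
      conv_rhs => rw [pi_eq_sum_univ' (F.charDivisor m)]
      rw [← Submodule.mkQ_apply, map_sum]
      refine Finset.sum_congr rfl fun ρ' _ => ?_
      rw [map_smul, divClass, Submodule.mkQ_apply]
    have hσ' : ∑ ρ' ∈ σ, F.charDivisor m ρ' • F.divClass ρ' = F.divClass ρ := by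
      rw [Finset.sum_eq_single ρ]
      · rw [hc, ← hj]
        simp
      · intro ρ' hρ' hne
        obtain ⟨j', hj'⟩ := hb ρ' hρ'
        have : j' ≠ j := by
          rintro rfl
          exact hne (F.gen_injective (hj'.symm.trans hj))
        rw [hc, ← hj']
        simp [this]
      · exact fun h => absurd hρ h
    refine ⟨fun ρ' => - F.charDivisor m ρ', ?_⟩
    rw [← Finset.sum_add_sum_compl σ, hσ'] at h0
    simp only [neg_smul, Finset.sum_neg_distrib]
    exact eq_neg_of_add_eq_zero_left h0
  · refine ⟨Pi.single ρ 1, ?_⟩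
    rw [Finset.sum_eq_single ρ]
    · simp
    · intro ρ' _ h
      simp [h]
    · simp [hρ]

/-- The quotient of `ℂ^ι - Z` has locally trivial sheaves `O(D_i)` if homogeneous polynomials
`h ρ` of degree `[D_ρ]` do not vanish simultaneously outside of a cone. -/
lemma locallyTrivial {ι : Type} (f : ι → R) (Z : Set (ι → ℂ))
    (H : ∀ p : Cover Z, ∃ σ ∈ F.cones, ∃ h : R → MvPolynomial ι ℂ,
      (∀ ρ, h ρ ∈ Homog (fun i => F.divClass (f i)) (F.divClass ρ)) ∧
        ∀ ρ ∈ σᶜ, MvPolynomial.eval p.pt (h ρ) ≠ 0) :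
    LocallyTrivial (fun i => F.divClass (f i)) Z := by
  intro p
  obtain ⟨σ, hσ, h, hh, hp⟩ := H p
  have hO : {x : Cover Z | MvPolynomial.eval x.pt (∏ ρ ∈ σᶜ, h ρ) ≠ 0} =
      {x : Cover Z | ∀ ρ ∈ σᶜ, MvPolynomial.eval x.pt (h ρ) ≠ 0} := by
    ext x
    simp [Finset.prod_ne_zero_iff, map_prod]
  have hopen := isOpen_eval_ne_zero (Z := Z) (∏ ρ ∈ σᶜ, h ρ)
  rw [hO] at hopen
  obtain ⟨U, hU⟩ := exists_preim_eq (deg := fun i => F.divClass (f i)) hopen (by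
    intro g x y hxy hx ρ hρ
    have := eval_act (hh ρ) g x.pt
    rw [← hxy] at this
    exact ne_of_eq_of_ne this (mul_ne_zero (character_ne_zero _ _) (hx ρ hρ)))
  have hpU : p ∈ preim _ Z U := by
    rw [hU]
    exact hp
  have hne : ∀ x ∈ preim _ Z U, ∀ ρ ∈ σᶜ, MvPolynomial.eval x.pt (h ρ) ≠ 0 := by
    intro x hx
    rw [hU] at hx
    exact hx
  choose c hc using F.exists_divClass_eq hσ
  -- A Laurent monomial in the nonvanishing `h ρ`, with exponents expressing the class of `i`
  -- through the divisors outside `σ`.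
  refine ⟨U, hpU, fun i x => ∏ ρ ∈ σᶜ, MvPolynomial.eval x.1.pt (h ρ) ^ c (f i) ρ, fun i => ?_⟩
  change IsUnitOfWeight U (F.divClass (f i)) _
  rw [hc]
  exact IsUnitOfWeight.prod _ fun ρ hρ =>
    (IsUnitOfWeight.of_homog (hh ρ) fun x hx => hne x hx ρ hρ).zpow _

lemma exists_prod_ne_zero {x : R → ℂ} (hx : x ∉ F.irrelevantLocus) :
    ∃ σ ∈ F.cones, ∀ ρ ∈ σᶜ, x ρ ≠ 0 := by
  simp only [irrelevantLocus, Set.mem_ofPred_eq, not_forall] at hx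
  obtain ⟨σ, hσ, h⟩ := hx
  exact ⟨σ, hσ, Finset.prod_ne_zero_iff.1 h⟩

lemma locallyTrivial_divClass : LocallyTrivial F.divClass F.irrelevantLocus := by
  refine F.locallyTrivial id _ fun p => ?_
  obtain ⟨σ, hσ, h⟩ := F.exists_prod_ne_zero p.notMem
  exact ⟨σ, hσ, MvPolynomial.X, fun ρ => MvPolynomial.isWeightedHomogeneous_X ℂ F.divClass ρ,
    fun ρ hρ => by simpa using h ρ hρ⟩

variable (β : F.CurveClass)

lemma exists_mapAt_notMem {f : F.EdgeSymbol β → ℂ} (hf : f ∉ F.badMaps β) :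
    ∃ t₀ t₁ : ℂ, F.mapAt β f t₀ t₁ ∉ F.irrelevantLocus := by
  simpa [badMaps] using hf

/-- For fixed `t` with `f(t)` outside $Z(\Sigma)$, the values $f_\rho(t)$ are linear forms in the
coordinates of `f`, of degree $[D_\rho]$. They play the role of the $x_\rho$. -/
lemma locallyTrivial_edgeClass : LocallyTrivial (F.edgeClass β) (F.badMaps β) := by
  refine F.locallyTrivial Sigma.fst _ fun p => ?_
  obtain ⟨t₀, t₁, ht⟩ := F.exists_mapAt_notMem β p.notMem
  obtain ⟨σ, hσ, h⟩ := F.exists_prod_ne_zero ht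
  refine ⟨σ, hσ, fun ρ => ∑ i : Fin (F.sectionCount β ρ),
    (t₀ ^ (i : ℕ) * t₁ ^ ((F.deg β ρ).toNat - (i : ℕ))) • MvPolynomial.X ⟨ρ, i⟩, fun ρ => ?_,
    fun ρ hρ => ?_⟩
  · exact Submodule.sum_mem _ fun i _ => Submodule.smul_mem _ _
      (MvPolynomial.isWeightedHomogeneous_X ℂ (F.edgeClass β) (⟨ρ, i⟩ : F.EdgeSymbol β))
  · have : MvPolynomial.eval p.pt (∑ i : Fin (F.sectionCount β ρ),
        (t₀ ^ (i : ℕ) * t₁ ^ ((F.deg β ρ).toNat - (i : ℕ))) •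
          (MvPolynomial.X ⟨ρ, i⟩ : MvPolynomial (F.EdgeSymbol β) ℂ)) = F.mapAt β p.pt t₀ t₁ ρ := by
      rw [map_sum]
      refine Finset.sum_congr rfl fun i _ => ?_
      rw [MvPolynomial.smul_eval, MvPolynomial.eval_X]
      ring
    rw [this]
    exact h ρ hρ

end SmoothProjectiveFan

/-! ### Substituting a map from the projective line -/

/-- Evaluation of a form of degree `d` in two variables. -/
lemma MvPolynomial.IsWeightedHomogeneous.eval₂_fin_two {S T : Type*} [CommRing S] [CommRing T]
    {Q : MvPolynomial (Fin 2) S} {d : ℤ}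
    (hQ : Q.IsWeightedHomogeneous (fun _ : Fin 2 => (1 : ℤ)) d) (φ : S →+* T) (t₀ t₁ : T) :
    Q.eval₂ φ ![t₀, t₁] = ∑ i : Fin (d + 1).toNat,
      φ (Q.coeff (Finsupp.single 0 (i : ℕ) + Finsupp.single 1 (d.toNat - (i : ℕ)))) *
        (t₀ ^ (i : ℕ) * t₁ ^ (d.toNat - (i : ℕ))) := by
  classical
  let e : Fin (d + 1).toNat → Fin 2 →₀ ℕ := fun i =>
    Finsupp.single 0 (i : ℕ) + Finsupp.single 1 (d.toNat - (i : ℕ))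
  have he0 : ∀ i, e i 0 = i := fun i => by simp [e]
  have he1 : ∀ i, e i 1 = d.toNat - i := fun i => by simp [e]
  have hinj : Function.Injective e := fun i j h => Fin.ext (by rw [← he0 i, h, he0])
  -- Exponents in the support satisfy `m 0 + m 1 = d`. For negative `d` there are none, matching the
  -- empty index type `Fin (d + 1).toNat`.
  have hsub : Q.support ⊆ Finset.univ.image e := by
    intro m hm
    have hw := hQ (MvPolynomial.mem_support_iff.1 hm)
    rw [Finsupp.weight_apply, Finsupp.sum_fintype _ _ (by simp), Fin.sum_univ_two] at hw
    simp only [nsmul_eq_mul, mul_one] at hw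
    refine Finset.mem_image.2 ⟨⟨m 0, by omega⟩, Finset.mem_univ _, ?_⟩
    ext k
    fin_cases k
    · exact he0 _
    · refine (he1 _).trans ?_
      change d.toNat - m 0 = m 1
      omega
  rw [MvPolynomial.eval₂_eq', Finset.sum_subset hsub (fun m _ hm => by
    rw [MvPolynomial.notMem_support_iff.1 hm, map_zero, zero_mul]), Finset.sum_image hinj.injOn]
  refine Finset.sum_congr rfl fun i _ => ?_
  rw [Fin.prod_univ_two, he0, he1]
  rfl

namespace SmoothProjectiveFan

open Cox

variable {n : ℕ} {R : Type} [Fintype R] [DecidableEq R] (F : SmoothProjectiveFan n R)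
  (β : F.CurveClass)

lemma isWeightedHomogeneous_genericSection (ρ : R) :
    (F.genericSection β ρ).IsWeightedHomogeneous (fun _ : Fin 2 => (1 : ℤ)) (F.deg β ρ) := by
  refine MvPolynomial.IsWeightedHomogeneous.sum _ _ _ fun i _ => ?_
  -- The existence of an index `i` forces `F.deg β ρ ≥ 0`, so neither `toNat` nor the subtraction
  -- truncates.
  have hi : (i : ℕ) < (F.deg β ρ + 1).toNat := i.2
  have h := ((MvPolynomial.isWeightedHomogeneous_C (fun _ : Fin 2 => (1 : ℤ))
    (MvPolynomial.X (R := ℂ) (⟨ρ, i⟩ : F.EdgeSymbol β))).mul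
      ((MvPolynomial.isWeightedHomogeneous_X _ (fun _ : Fin 2 => (1 : ℤ)) 0).pow (i : ℕ))).mul
      ((MvPolynomial.isWeightedHomogeneous_X _ (fun _ : Fin 2 => (1 : ℤ)) 1).pow
        ((F.deg β ρ).toNat - (i : ℕ)))
  convert h using 1
  simp only [nsmul_eq_mul, mul_one]
  omega

/-- Substituting the components of a map of class `β` turns polynomials of degree `a` into forms
of degree `β a` on `ℙ¹`. -/
lemma isWeightedHomogeneous_aeval_genericSection {a : F.Pic} {p : MvPolynomial R ℂ}
    (hp : p ∈ Homog F.divClass a) :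
    (MvPolynomial.aeval (F.genericSection β) p).IsWeightedHomogeneous
      (fun _ : Fin 2 => (1 : ℤ)) (β a) := by
  rw [MvPolynomial.aeval_def, MvPolynomial.eval₂_eq]
  refine MvPolynomial.IsWeightedHomogeneous.sum _ _ _ fun d hd => ?_
  have h1 := MvPolynomial.IsWeightedHomogeneous.prod d.support
    (fun i => F.genericSection β i ^ d i) (fun i => d i • F.deg β i)
    fun i _ => (F.isWeightedHomogeneous_genericSection β i).pow (d i)
  have h2 : ∑ i ∈ d.support, d i • F.deg β i = β a := by
    rw [← hp (MvPolynomial.mem_support_iff.1 hd), Finsupp.weight_apply, Finsupp.sum, map_sum]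
    exact Finset.sum_congr rfl fun i _ => (map_nsmul β _ _).symm
  rw [h2] at h1
  have h3 := (MvPolynomial.isWeightedHomogeneous_C (fun _ : Fin 2 => (1 : ℤ))
    (algebraMap ℂ (MvPolynomial (F.EdgeSymbol β) ℂ) (p.coeff d))).mul h1
  rwa [zero_add] at h3

/-- Both sides are ring homomorphisms in `p`, so it is enough to compare constants and variables. -/
lemma eval_mapAt (f : F.EdgeSymbol β → ℂ) (t₀ t₁ : ℂ) (p : MvPolynomial R ℂ) :
    MvPolynomial.eval (F.mapAt β f t₀ t₁) p =
      (MvPolynomial.aeval (F.genericSection β) p).eval₂ (MvPolynomial.eval f) ![t₀, t₁] := by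
  have h : MvPolynomial.eval (F.mapAt β f t₀ t₁) =
      (MvPolynomial.eval₂Hom (MvPolynomial.eval f) ![t₀, t₁]).comp
        (MvPolynomial.aeval (R := ℂ) (F.genericSection β)).toRingHom := by
    refine MvPolynomial.ringHom_ext (fun c => ?_) fun ρ => ?_
    · have : algebraMap ℂ (MvPolynomial (Fin 2) (MvPolynomial (F.EdgeSymbol β) ℂ)) c =
        MvPolynomial.C (MvPolynomial.C c) := rfl
      simp [this]
    · simp [genericSection, mapAt]
  exact congrArg (· p) h

/-- The value of `E_ρ` at `f(t)` is `∑_i E_{ρ_i}(f) t₀^i t₁^(d_ρ - i)`. -/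
lemma evalW_mapAt (E : ∀ ρ, Homog F.divClass (F.divClass ρ) ⊗[ℂ] WSpace F.Pic)
    (f : F.EdgeSymbol β → ℂ) (t₀ t₁ : ℂ) (ρ : R) :
    evalW F.divClass (F.mapAt β f t₀ t₁) (E ρ) = ∑ i : Fin (F.sectionCount β ρ),
      (t₀ ^ (i : ℕ) * t₁ ^ ((F.deg β ρ).toNat - (i : ℕ))) •
        evalW (F.edgeClass β) f (F.inducedSections β E ⟨ρ, i⟩) := by
  simp only [inducedSections]
  generalize E ρ = e
  induction e with
  | zero => simp
  | add e e' he he' => simp only [map_add, he, he', smul_add, Finset.sum_add_distrib]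
  | tmul p w =>
    have h := F.eval_mapAt β f t₀ t₁ p.1
    -- Homogeneity in `t` guarantees that the coefficients kept in `coeffMap` are all the
    -- coefficients of `p(f(t))`.
    rw [(F.isWeightedHomogeneous_aeval_genericSection β p.2).eval₂_fin_two] at h
    have h' : evalW F.divClass (F.mapAt β f t₀ t₁) (p ⊗ₜ[ℂ] w) =
        MvPolynomial.eval (F.mapAt β f t₀ t₁) p.1 • w := rfl
    rw [h', h, Finset.sum_smul]
    refine Finset.sum_congr rfl fun i _ => ?_
    rw [mul_comm, mul_smul]
    rfl

/-- If the values of the `E_ρ` span `W` outside of `Z(Σ)`, then those of the `E_{ρ_i}` span `W`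
outside of `Z_β`. -/
lemma span_evalW_inducedSections
    (E : ∀ ρ, Homog F.divClass (F.divClass ρ) ⊗[ℂ] WSpace F.Pic)
    (h : ∀ p : Cover F.irrelevantLocus,
      Submodule.span ℂ (Set.range fun ρ => evalW F.divClass p.pt (E ρ)) = ⊤)
    (p : Cover (F.badMaps β)) : Submodule.span ℂ
      (Set.range fun k => evalW (F.edgeClass β) p.pt (F.inducedSections β E k)) = ⊤ := by
  obtain ⟨t₀, t₁, ht⟩ := F.exists_mapAt_notMem β p.notMem
  -- The whole of `W` is rewritten as the span of the values $E_\rho(f(t))$ at a good `t`.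
  rw [eq_top_iff, ← h ⟨_, ht⟩, Submodule.span_le]
  rintro _ ⟨ρ, rfl⟩
  change evalW F.divClass (F.mapAt β p.pt t₀ t₁) (E ρ) ∈ _
  rw [evalW_mapAt]
  exact Submodule.sum_mem _ fun i _ =>
    Submodule.smul_mem _ _ (Submodule.subset_span ⟨⟨ρ, i⟩, rfl⟩)

end SmoothProjectiveFan

end

theorem proposition4 {n : ℕ} {R : Type} [Fintype R] [DecidableEq R] (F : SmoothProjectiveFan n R)
    (β : F.CurveClass)
    (E : ∀ ρ : R, Cox.Homog F.divClass (F.divClass ρ) ⊗[ℂ] Cox.WSpace F.Pic)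
    (hmono : Mono (Cox.eulerMap F.divClass F.irrelevantLocus E))
    (hfree : (Cox.eulerCokernel F.divClass F.irrelevantLocus E).IsLocallyFree) :
    Mono (Cox.eulerMap (F.edgeClass β) (F.badMaps β) (F.inducedSections β E)) ∧
      (Cox.eulerCokernel (F.edgeClass β) (F.badMaps β) (F.inducedSections β E)).IsLocallyFree := by
  have h := F.span_evalW_inducedSections β E
    (Cox.span_evalW_eq_top F.locallyTrivial_divClass E hfree)
  exact ⟨Cox.mono_eulerMap _ h,
    Cox.isLocallyFree_eulerCokernel (F.locallyTrivial_edgeClass β) _ h⟩
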